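/- Types are $\sigma ::= p \mid \sigma\supset\sigma \mid \Box\sigma$, with $p$ ranging over a set of type constants. The terms and the values of the call-by-value $\lambda\Box$-calculus are $$M ::= c^{\tau} \mid x \mid \lambda x^{\sigma}.M \mid M\,M \mid \mathtt{box}\ x_1^{\sigma_1},\ldots,x_n^{\sigma_n}=M_1,\ldots,M_n\ \mathtt{in}\ V,$$ $$V ::= c^{\tau} \mid x \mid \lambda x^{\sigma}.M \mid \mathtt{box}\ x_1^{\sigma_1},\ldots,x_n^{\sigma_n}=V_1,\ldots,V_n\ \mathtt{in}\ V \qquad (n\ge 0),$$ taken up to $\alpha$-equivalence; the variables $x_1,\ldots,x_n$ are bound in the body of a box, and the free variables of $\mathtt{box}\ \vec x=\vec N\ \mathtt{in}\ M$ are those of $\vec N$. The typing rules are those of the simply typed $\lambda$-calculus (with $\Gamma\vdash c^\tau:\tau$ for every constant) and: if $x_1:\sigma_1,\ldots,x_n:\sigma_n\vdash M:\tau$ and $\Gamma\vdash N_i:\Box\sigma_i$ for $i=1,\ldots,n$, then $\Gamma\vdash \mathtt{box}\ x_1^{\sigma_1},\ldots,x_n^{\sigma_n}=N_1,\ldots,N_n\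 \mathtt{in}\ M:\Box\tau$. Simple evaluation contexts and evaluation contexts are $$C ::= {-}\,M \mid V\,{-} \mid \mathtt{box}\ \vec x=V,\ldots,V,{-},M,\ldots,M\ \mathtt{in}\ V,\qquad E ::= {-} \mid C[E].$$ The reduction $\to_{\mathsf v}$ is the closure under arbitrary term contexts (including the bodies of abstractions and of boxes) of the following rules, in which $V$ and the members of $\vec W$ are values and no free variable is captured: \begin{align*} (\lambda x.x)M &\to M && (\mathrm{id}_\supset)\\ (\lambda x.M)V &\to M[x:=V] && (\beta_{\supset}^{v})\\ \lambda x.Vx &\to V,\quad x\notin FV(V) && (\eta_{\supset}^{v})\\ C[(\lambda x.M)N] &\to (\lambda x.C[M])N && (\mathrm{lift})\\ C[yM] &\to (\lambda x.C[x])(yM),\quad y \text{ a variable},\ C\text{ not of the form }V\,{-} && (\mathrm{flat})\\ (\lambda x.E[yx])M &\to E[yM],\quad x\notin FV(E[y]) && (\beta_\Omega)\\ \mathtt{box}\ x=M\ \mathtt{in}\ x &\to M && (\mathrm{id}_\Box)\\ \mathtt{box}\ \vec w,x,\vec z=\vec W,(\mathtt{box}\ \vec y=\vec N\ \mathtt{in}\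 V),\vec P\ \mathtt{in}\ M &\to \mathtt{box}\ \vec w,\vec y,\vec z=\vec W,\vec N,\vec P\ \mathtt{in}\ M[x:=V],\quad |\vec w|=|\vec W| && (\beta_\Box^{v}) \end{align*} (in (flat), the new binder $x$ is annotated with the type of $yM$). Statement (strong normalization, call-by-value): if $\Gamma\vdash M:\tau$ for a term $M$ of this calculus, then there is no infinite reduction sequence $M\to_{\mathsf v}M_1\to_{\mathsf v}M_2\to_{\mathsf v}\cdots$. -/

import Mathlib

/-- Types `σ ::= p | σ ⊃ σ | □σ`, with `p` ranging over the type constants `P`. -/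
inductive Ty (P : Type*) where
  | base : P → Ty P
  | arr : Ty P → Ty P → Ty P
  | box : Ty P → Ty P

/-- Raw terms up to α-equivalence (de Bruijn indices).
* `const c τ` is the constant `c` annotated with its type `τ`.
* `lam σ M` is `λx^σ. M`; in `M` the index `0` is `x`, the other indices are shifted by one.
* `box Δ Ns M` is `box x₁^σ₁, …, xₙ^σₙ = N₁, …, Nₙ in M` where `Δ = [σ₁, …, σₙ]` and
  `Ns = [N₁, …, Nₙ]`. The body `M` has a scope of its own, in which the index `i` is `xᵢ₊₁`:
  the free variables of the box are those of `N₁, …, Nₙ` only. -/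
inductive Tm (P C : Type*) where
  | const : C → Ty P → Tm P C
  | var : ℕ → Tm P C
  | lam : Ty P → Tm P C → Tm P C
  | app : Tm P C → Tm P C → Tm P C
  | box : List (Ty P) → List (Tm P C) → Tm P C → Tm P C

namespace Tm

variable {P C : Type*}

/-- Extension of a renaming under a `λ`. -/
def upRen (ρ : ℕ → ℕ) : ℕ → ℕ
  | 0 => 0
  | i + 1 => ρ i + 1

mutual
/-- Renaming of the free variables (the body of a box has none). -/
def rename (ρ : ℕ → ℕ) : Tm P C → Tm P C
  | const c τ => const c τ
  | var i => var (ρ i)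
  | lam σ M => lam σ (rename (upRen ρ) M)
  | app M N => app (rename ρ M) (rename ρ N)
  | box Δ Ns M => box Δ (renameList ρ Ns) M
/-- Renaming in a list of terms. -/
def renameList (ρ : ℕ → ℕ) : List (Tm P C) → List (Tm P C)
  | [] => []
  | N :: Ns => rename ρ N :: renameList ρ Ns
end

/-- Weakening by one fresh variable, which gets the index `0`. -/
def shift (M : Tm P C) : Tm P C := rename Nat.succ M

/-- Extension of a substitution under a `λ`. -/
def upSub (s : ℕ → Tm P C) : ℕ → Tm P C
  | 0 => var 0
  | i + 1 => shift (s i)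

mutual
/-- Simultaneous capture-avoiding substitution for the free variables. -/
def subst (s : ℕ → Tm P C) : Tm P C → Tm P C
  | const c τ => const c τ
  | var i => s i
  | lam σ M => lam σ (subst (upSub s) M)
  | app M N => app (subst s M) (subst s N)
  | box Δ Ns M => box Δ (substList s Ns) M
/-- Substitution in a list of terms. -/
def substList (s : ℕ → Tm P C) : List (Tm P C) → List (Tm P C)
  | [] => []
  | N :: Ns => subst s N :: substList s Ns
end

/-- The substitution `x := N` for the variable `x` with index `0`, which is removed. -/
def single (N : Tm P C) : ℕ → Tm P C
  | 0 => N
  | i + 1 => var i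

/-- The substitution `x := V` from the scope `w₁, …, wₘ, x, z₁, …` to the scope
`w₁, …, wₘ, y₁, …, yₙ, z₁, …`, where `V` lives in the scope `y₁, …, yₙ`. -/
def splice (m n : ℕ) (V : Tm P C) (i : ℕ) : Tm P C :=
  if i < m then var i
  else if i = m then rename (fun j => m + j) V
  else var (i - 1 + n)

/-- The typing judgement `Γ ⊢ M : τ`; the index `i` has the `i`-th type of the list `Γ`. -/
inductive HasType : List (Ty P) → Tm P C → Ty P → Prop
  | const {Γ : List (Ty P)} (c : C) (τ : Ty P) : HasType Γ (const c τ) τ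
  | var {Γ : List (Ty P)} {i : ℕ} {τ : Ty P} : Γ[i]? = some τ → HasType Γ (var i) τ
  | lam {Γ : List (Ty P)} {σ τ : Ty P} {M : Tm P C} :
      HasType (σ :: Γ) M τ → HasType Γ (lam σ M) (Ty.arr σ τ)
  | app {Γ : List (Ty P)} {σ τ : Ty P} {M N : Tm P C} :
      HasType Γ M (Ty.arr σ τ) → HasType Γ N σ → HasType Γ (app M N) τ
  | box {Γ Δ : List (Ty P)} {τ : Ty P} {Ns : List (Tm P C)} {M : Tm P C} :
      Ns.length = Δ.length →
      (∀ (i : ℕ) (N : Tm P C) (σ : Ty P),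
        Ns[i]? = some N → Δ[i]? = some σ → HasType Γ N (Ty.box σ)) →
      HasType Δ M τ → HasType Γ (box Δ Ns M) (Ty.box τ)

/-- Values `V ::= c | x | λx. M | box x⃗ = V, …, V in M`. -/
inductive IsValue : Tm P C → Prop
  | const (c : C) (τ : Ty P) : IsValue (const c τ)
  | var (i : ℕ) : IsValue (var i)
  | lam (σ : Ty P) (M : Tm P C) : IsValue (lam σ M)
  | box (Δ : List (Ty P)) (Vs : List (Tm P C)) (M : Tm P C) :
      (∀ V ∈ Vs, IsValue V) → IsValue (box Δ Vs M)

/-- The terms of the call-by-value calculus: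
`M ::= c | x | λx. M | M M | box x⃗ = M, …, M in V`, i.e. the body of every box is a value. -/
inductive IsCbv : Tm P C → Prop
  | const (c : C) (τ : Ty P) : IsCbv (const c τ)
  | var (i : ℕ) : IsCbv (var i)
  | lam (σ : Ty P) {M : Tm P C} : IsCbv M → IsCbv (lam σ M)
  | app {M N : Tm P C} : IsCbv M → IsCbv N → IsCbv (app M N)
  | box (Δ : List (Ty P)) {Ns : List (Tm P C)} {V : Tm P C} :
      (∀ N ∈ Ns, IsCbv N) → IsValue V → IsCbv V → IsCbv (box Δ Ns V)

end Tm

/-- One-layer contexts with one hole: `- M`, `M -` and `box x⃗ = Ls, -, Ns in M`. -/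
inductive Frame (P C : Type*) where
  | appL : Tm P C → Frame P C
  | appR : Tm P C → Frame P C
  | box : List (Ty P) → List (Tm P C) → List (Tm P C) → Tm P C → Frame P C

namespace Frame

variable {P C : Type*}

/-- Filling the hole. -/
def plug : Frame P C → Tm P C → Tm P C
  | appL N, M => Tm.app M N
  | appR V, M => Tm.app V M
  | box Δ Ls Ns B, M => Tm.box Δ (Ls ++ M :: Ns) B

/-- Weakening by one fresh variable, which gets the index `0`. -/
def shift : Frame P C → Frame P C
  | appL N => appL N.shift
  | appR V => appR V.shift
  | box Δ Ls Ns B => box Δ (Ls.map Tm.shift) (Ns.map Tm.shift) B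

/-- Simple evaluation contexts `C ::= - M | V - | box x⃗ = V, …, V, -, M, …, M in M`. -/
def IsSimple : Frame P C → Prop
  | appL _ => True
  | appR V => V.IsValue
  | box _ Vs _ _ => ∀ V ∈ Vs, V.IsValue

/-- The frame has the form `V -`. -/
def IsAppR : Frame P C → Prop
  | appR _ => True
  | _ => False

/-- Filling the hole of a stack of frames `C₁[C₂[⋯ - ⋯]]`, written `[C₁, C₂, …]`. -/
def plugs (E : List (Frame P C)) (M : Tm P C) : Tm P C := E.foldr plug M

/-- Evaluation contexts `E ::= - | C[E]`. -/
def IsEval (E : List (Frame P C)) : Prop := ∀ F ∈ E, F.IsSimple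

end Frame

/-- The labels of the reduction rules. -/
inductive Rule where
  | idArr | betaArrV | etaArrV | lift | flat | betaOmega | idBox | betaBoxV

/-- The reduction set of the call-by-value calculus. -/
def rulesV : Set Rule :=
  {Rule.idArr, Rule.betaArrV, Rule.etaArrV, Rule.lift, Rule.flat, Rule.betaOmega,
    Rule.idBox, Rule.betaBoxV}

namespace Tm

variable {P C : Type*}

/-- `Contract r Γ M N`: the redex `M` contracts to `N` by the rule `r`. Side conditions of the form
`x ∉ FV(-)` are expressed by `shift`. The context `Γ` types the free variables of `M`; it serves
only to determine the annotation of the binder that `flat` creates. -/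
inductive Contract : Rule → List (Ty P) → Tm P C → Tm P C → Prop
  /-- `(λx. x) M ⟶ M` -/
  | idArr {Γ : List (Ty P)} (σ : Ty P) (M : Tm P C) :
      Contract Rule.idArr Γ (app (lam σ (var 0)) M) M
  /-- `(λx. M) V ⟶ M[x := V]` -/
  | betaArrV {Γ : List (Ty P)} (σ : Ty P) (M V : Tm P C) : IsValue V →
      Contract Rule.betaArrV Γ (app (lam σ M) V) (subst (single V) M)
  /-- `λx. V x ⟶ V` if `x ∉ FV(V)` -/
  | etaArrV {Γ : List (Ty P)} (σ : Ty P) (V : Tm P C) : IsValue V →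
      Contract Rule.etaArrV Γ (lam σ (app V.shift (var 0))) V
  /-- `C[(λx. M) N] ⟶ (λx. C[M]) N` -/
  | lift {Γ : List (Ty P)} (F : Frame P C) (σ : Ty P) (M N : Tm P C) : F.IsSimple →
      Contract Rule.lift Γ (F.plug (app (lam σ M) N)) (app (lam σ (F.shift.plug M)) N)
  /-- `C[y M] ⟶ (λx. C[x]) (y M)` if `C` is not of the form `V -` -/
  | flat {Γ : List (Ty P)} (F : Frame P C) (σ : Ty P) (y : ℕ) (M : Tm P C) :
      F.IsSimple → ¬ F.IsAppR → HasType Γ (app (var y) M) σ →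
      Contract Rule.flat Γ (F.plug (app (var y) M))
        (app (lam σ (F.shift.plug (var 0))) (app (var y) M))
  /-- `(λx. E[y x]) M ⟶ E[y M]` if `x ∉ FV(E[y])` -/
  | betaOmega {Γ : List (Ty P)} (E : List (Frame P C)) (σ : Ty P) (y : ℕ) (M : Tm P C) :
      Frame.IsEval E →
      Contract Rule.betaOmega Γ
        (app (lam σ (Frame.plugs (E.map Frame.shift) (app (var (y + 1)) (var 0)))) M)
        (Frame.plugs E (app (var y) M))
  /-- `box x = M in x ⟶ M` -/
  | idBox {Γ : List (Ty P)} (σ : Ty P) (M : Tm P C) :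
      Contract Rule.idBox Γ (box [σ] [M] (var 0)) M
  /-- `box w⃗, x, z⃗ = W⃗, (box y⃗ = N⃗ in V), P⃗ in M ⟶ box w⃗, y⃗, z⃗ = W⃗, N⃗, P⃗ in M[x := V]`
  if `|w⃗| = |W⃗|` -/
  | betaBoxV {Γ : List (Ty P)} (ws ys zs : List (Ty P)) (σ : Ty P)
      (Ws Ns Ps : List (Tm P C)) (V M : Tm P C) :
      ws.length = Ws.length → (∀ W ∈ Ws, IsValue W) → IsValue V →
      Contract Rule.betaBoxV Γ
        (box (ws ++ σ :: zs) (Ws ++ box ys Ns V :: Ps) M)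
        (box (ws ++ ys ++ zs) (Ws ++ Ns ++ Ps) (subst (splice ws.length ys.length V) M))

/-- `Step X Γ M N`: one reduction step by a rule in `X`, applied to any subterm of `M`;
`Γ` types the free variables. -/
inductive Step (X : Set Rule) : List (Ty P) → Tm P C → Tm P C → Prop
  | root {Γ : List (Ty P)} {M N : Tm P C} (r : Rule) :
      r ∈ X → Contract r Γ M N → Step X Γ M N
  | lam {Γ : List (Ty P)} {σ : Ty P} {M M' : Tm P C} :
      Step X (σ :: Γ) M M' → Step X Γ (lam σ M) (lam σ M')
  | appL {Γ : List (Ty P)} {M M' N : Tm P C} :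
      Step X Γ M M' → Step X Γ (app M N) (app M' N)
  | appR {Γ : List (Ty P)} {M N N' : Tm P C} :
      Step X Γ N N' → Step X Γ (app M N) (app M N')
  | boxArg {Γ Δ : List (Ty P)} {Ls Rs : List (Tm P C)} {N N' M : Tm P C} :
      Step X Γ N N' → Step X Γ (box Δ (Ls ++ N :: Rs) M) (box Δ (Ls ++ N' :: Rs) M)
  | boxBody {Γ Δ : List (Ty P)} {Ns : List (Tm P C)} {M M' : Tm P C} :
      Step X Δ M M' → Step X Γ (box Δ Ns M) (box Δ Ns M')

/-- `M` is strongly normalizing for the rules in `X`: there is no infinite reduction sequence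
from `M` (accessibility for the converse of the reduction relation). -/
def StronglyNormalizing (X : Set Rule) (Γ : List (Ty P)) (M : Tm P C) : Prop :=
  Acc (fun N' N => Step X Γ N N') M

end Tm

-- A typed term is interpreted in continuation-passing style with natural numbers as answers, and
-- reduction makes these numbers drop. Application and box run their parts from left to right; a
-- value hands an element to its continuation at once (`Den.exists_value`), so substituting a value
-- amounts to changing the environment (`Den.subst`). `Dom.Rel` is strict monotonicity in
-- quantitative form: the gaps between arguments and between continuations add up in the answer.
-- Every denotation is related to itself at gap 0 (`Den.self`), and the same congruence lemmas carry
-- a gap of 1 created at a redex through any term context.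
--
-- The gaps come from charges built into the denotation. `absD` charges the measure of the argument
-- plus 1: the measure keeps the dependence strict when the body ignores its variable, and the 1
-- pays for the identity, beta, eta and beta-Omega rules on functions. In the same way `consB`
-- charges the measure of the content of a box argument, and the 1 in `boxD` pays for the two box
-- rules. Finally `cost` charges the measure plus 2 for a non-value in function position or among
-- box arguments. The flat rule trades this for the measure plus 1 of its new abstraction. The hole
-- of `V -` carries no charge, and there flat is forbidden.
--
-- Only lift may leave the denotation unchanged. It never raises it, preserves the size and lowers
-- `weight`. Hence the answer in the default environment with the measuring continuation, paired
-- lexicographically with `weight`, strictly decreases (`Step.den`). As `Den` contains the typing,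
-- subject reduction is obtained along with the comparison.

/-- Semantic domains: a continuation-passing interpretation with answers in `ℕ`. -/
def Dom {P : Type*} : Ty P → Type
  | .base _ => ℕ
  | .arr σ τ => Dom σ → (Dom τ → ℕ) → ℕ
  | .box σ => (Dom σ → ℕ) → ℕ

-- The graded logical relation and the measure of an element.

namespace Dom

variable {P : Type*}

/-- The graded logical relation on the domains: `Rel τ s a b` says that `a` is below `b` with
a gap of at least `s`, hereditarily along strictly monotone arguments. -/
def Rel : (τ : Ty P) → ℕ → Dom τ → Dom τ → Prop
  | .base _, s, a, b => (show ℕ from a) + s ≤ (show ℕ from b)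
  | .arr σ τ, s, f, g => ∀ (t u : ℕ) (a b : Dom σ) (k l : Dom τ → ℕ), Rel σ t a b →
      (∀ v c d, Rel τ v c d → k c + u + v ≤ l d) → f a k + s + t + u ≤ g b l
  | .box σ, s, f, g => ∀ (u : ℕ) (k l : Dom σ → ℕ),
      (∀ v c d, Rel σ v c d → k c + u + v ≤ l d) → f k + s + u ≤ g l

/-- The relation on continuations that belongs to `Rel`. -/
def KRel (τ : Ty P) (u : ℕ) (k l : Dom τ → ℕ) : Prop :=
  ∀ v c d, Rel τ v c d → k c + u + v ≤ l d

theorem Rel.arr {σ τ : Ty P} {s t u : ℕ} {f g : Dom (.arr σ τ)} {a b : Dom σ} {k l : Dom τ → ℕ}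
    (h : Rel (.arr σ τ) s f g) (hab : Rel σ t a b) (hk : KRel τ u k l) :
    f a k + s + t + u ≤ g b l := h t u a b k l hab hk

theorem Rel.box {σ : Ty P} {s u : ℕ} {f g : Dom (.box σ)} {k l : Dom σ → ℕ}
    (h : Rel (.box σ) s f g) (hk : KRel σ u k l) : f k + s + u ≤ g l := h u k l hk

theorem Rel.mono {τ : Ty P} {s t : ℕ} {a b : Dom τ} (h : Rel τ s a b) (hts : t ≤ s) :
    Rel τ t a b := by
  cases τ with
  | base p => exact le_trans (Nat.add_le_add_left hts _) h
  | arr σ τ => intro t' u a b k l hab hk; have := h t' u a b k l hab hk; omega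
  | box σ => intro u k l hk; have := h u k l hk; omega

/-- A self-related element and a self-related continuation of each type. -/
def base : (τ : Ty P) → Dom τ × (Dom τ → ℕ)
  | .base _ => ((0 : ℕ), fun a => a)
  | .arr σ τ => (fun a k => (base σ).2 a + k (base τ).1, fun f => f (base σ).1 (base τ).2)
  | .box σ => (fun k => k (base σ).1, fun b => b (base σ).2)

/-- The default element. -/
def dflt (τ : Ty P) : Dom τ := (base τ).1

/-- The size of an element. -/
def meas (τ : Ty P) : Dom τ → ℕ := (base τ).2

/-- Default and measure must be built together: measuring a function applies it to a default
argument and a measuring continuation, while the default function adds the measure of its argument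
in order to be strict in it. -/
theorem base_rel (τ : Ty P) : Rel τ 0 (dflt τ) (dflt τ) ∧ KRel τ 0 (meas τ) (meas τ) := by
  induction τ with
  | base p =>
    refine ⟨le_rfl, fun v c d h => ?_⟩
    have h' : (show ℕ from c) + v ≤ (show ℕ from d) := h
    change (show ℕ from c) + 0 + v ≤ (show ℕ from d)
    omega
  | arr σ τ ihσ ihτ =>
    refine ⟨fun t u a b k l hab hk => ?_, fun v f g h => ?_⟩
    · have h1 := ihσ.2 t a b hab
      have h2 := hk 0 _ _ ihτ.1
      change meas σ a + k (dflt τ) + 0 + t + u ≤ meas σ b + l (dflt τ)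
      omega
    · have := Rel.arr h ihσ.1 ihτ.2
      change f (dflt σ) (meas τ) + 0 + v ≤ g (dflt σ) (meas τ)
      omega
  | box σ ih =>
    refine ⟨fun u k l hk => ?_, fun v f g h => ?_⟩
    · have := hk 0 _ _ ih.1
      change k (dflt σ) + 0 + u ≤ l (dflt σ)
      omega
    · have := Rel.box h ih.2
      change f (meas σ) + 0 + v ≤ g (meas σ)
      omega

theorem meas_rel {τ : Ty P} {s : ℕ} {a b : Dom τ} (h : Rel τ s a b) :
    meas τ a + s ≤ meas τ b := by
  have := (base_rel τ).2 s a b h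
  omega

open Classical in
/-- An element of `Dom σ`, extended by default elements to all types. -/
noncomputable def inj {σ : Ty P} (a : Dom σ) (τ : Ty P) : Dom τ :=
  if h : σ = τ then h ▸ a else dflt τ

@[simp] theorem inj_self {σ : Ty P} (a : Dom σ) : inj a σ = a := by simp [inj]

/-- Continuations are rich enough to test the relation: the measure at base type, and application to
an argument and a continuation, or to a continuation, at the other types. This turns a comparison of
value denotations into one of elements. -/
theorem Rel.of_forall {τ : Ty P} {s : ℕ} {a b : Dom τ}
    (h : ∀ u k l, KRel τ u k l → k a + s + u ≤ l b) : Rel τ s a b := by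
  cases τ with
  | base p => exact h 0 _ _ (base_rel (.base p)).2
  | arr σ τ =>
    intro t u a' b' k l hab hk
    have := h (t + u) (fun f => f a' k) (fun f => f b' l) (fun v c d hcd => by
      have := Rel.arr hcd hab hk
      change c a' k + (t + u) + v ≤ d b' l
      omega)
    change a a' k + s + (t + u) ≤ b b' l at this
    omega
  | box σ =>
    intro u k l hk
    exact h u (fun f => f k) (fun f => f l) (fun v c d hcd => by
      have := Rel.box hcd hk
      change c k + u + v ≤ d l
      omega)

end Dom

/-- Prepending an element to a sequence. -/
def scons {A : Type*} (a : A) (f : ℕ → A) : ℕ → A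
  | 0 => a
  | i + 1 => f i

@[simp] theorem scons_zero {A : Type*} (a : A) (f : ℕ → A) : scons a f 0 = a := rfl
@[simp] theorem scons_succ {A : Type*} (a : A) (f : ℕ → A) (i : ℕ) : scons a f (i + 1) = f i := rfl

theorem scons_comp_succ {A : Type*} (a : A) (f : ℕ → A) : (fun i => scons a f (Nat.succ i)) = f := rfl

/-- The first `m` elements of `e`, followed by `f`. -/
def scat {A : Type*} (m : ℕ) (e f : ℕ → A) (i : ℕ) : A := if i < m then e i else f (i - m)

theorem scat_zero {A : Type*} (e f : ℕ → A) : scat 0 e f = f := by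
  funext i; simp [scat]

theorem scat_succ {A : Type*} (m : ℕ) (a : A) (e f : ℕ → A) :
    scat (m + 1) (scons a e) f = scons a (scat m e f) := by
  funext i; cases i <;> simp [scat, scons]

namespace Tm

variable {P C : Type*}

-- Environments, charges and the denotation.

/-- Semantic environments. -/
abbrev Env (P : Type*) := ℕ → ∀ τ : Ty P, Dom τ

/-- Typing contexts as partial functions. -/
abbrev Cx (P : Type*) := ℕ → Option (Ty P)

/-- The context given by a list. -/
def cx (Δ : List (Ty P)) : Cx P := fun i => Δ[i]?

theorem cx_cons (σ : Ty P) (Δ : List (Ty P)) : cx (σ :: Δ) = scons (some σ) (cx Δ) := by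
  funext i; cases i <;> simp [cx, scons]

open Classical in
/-- The price of evaluating `M` before its value `a` is used: values are free. -/
noncomputable def cost (M : Tm P C) {τ : Ty P} (a : Dom τ) : ℕ :=
  if IsValue M then 0 else Dom.meas τ a + 2

theorem cost_value {M : Tm P C} (h : IsValue M) {τ : Ty P} (a : Dom τ) : cost M a = 0 := by
  simp [cost, h]

theorem cost_not {M : Tm P C} (h : ¬ IsValue M) {τ : Ty P} (a : Dom τ) :
    cost M a = Dom.meas τ a + 2 := by
  simp [cost, h]

/-- The denotation of a `λ`-abstraction with body `f`. -/
noncomputable def absD {σ τ : Ty P} (f : Env P → (Dom τ → ℕ) → ℕ) (ρ : Env P) :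
    Dom (.arr σ τ) :=
  fun a k => f (scons (Dom.inj a) ρ) k + Dom.meas σ a + 1

/-- The denotation of a box with arguments `B` and body `v`. -/
def boxD {τ : Ty P} (v : Env P → Dom τ) (B : (Env P → ℕ) → ℕ) : Dom (.box τ) :=
  fun k => B (fun e => k (v e)) + 1

/-- Prepending a box argument. -/
noncomputable def consB {σ : Ty P} (b : Dom (.box σ)) (B : (Env P → ℕ) → ℕ) : (Env P → ℕ) → ℕ :=
  fun κ => b (fun x => B (fun e => κ (scons (Dom.inj x) e)) + Dom.meas σ x)

/-- Concatenation of two lists of box arguments, the first of length `m`. -/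
def catB (m : ℕ) (A B : (Env P → ℕ) → ℕ) : (Env P → ℕ) → ℕ :=
  fun κ => A (fun e => B (fun e' => κ (scat m e e')))

/-- The environment of default elements. -/
def dEnv : Env P := fun _ τ => Dom.dflt τ

mutual
/-- `Den Γ M τ f`: the term `M` has type `τ` in `Γ` and denotation `f`; box bodies are values. -/
inductive Den : Cx P → Tm P C → (τ : Ty P) → (Env P → (Dom τ → ℕ) → ℕ) → Prop
  | const {Γ : Cx P} (c : C) (τ : Ty P) : Den Γ (.const c τ) τ (fun _ k => k (Dom.dflt τ))
  | var {Γ : Cx P} {i : ℕ} {τ : Ty P} : Γ i = some τ → Den Γ (.var i) τ (fun ρ k => k (ρ i τ))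
  | lam {Γ : Cx P} {σ τ : Ty P} {M : Tm P C} {f : Env P → (Dom τ → ℕ) → ℕ} :
      Den (scons (some σ) Γ) M τ f → Den Γ (.lam σ M) (.arr σ τ) (fun ρ k => k (absD f ρ))
  | app {Γ : Cx P} {σ τ : Ty P} {M N : Tm P C} {f : Env P → (Dom (.arr σ τ) → ℕ) → ℕ}
      {g : Env P → (Dom σ → ℕ) → ℕ} :
      Den Γ M (.arr σ τ) f → Den Γ N σ g →
      Den Γ (.app M N) τ (fun ρ k => f ρ (fun φ => g ρ (fun a => φ a k) + cost M φ))
  | box {Γ : Cx P} {Δ : List (Ty P)} {τ : Ty P} {Ns : List (Tm P C)} {V : Tm P C}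
      {F : Env P → (((Env P → ℕ) → ℕ) → ℕ) → ℕ} {v : Env P → Dom τ} :
      DenL Γ Ns Δ F → IsValue V → Den (cx Δ) V τ (fun e k => k (v e)) →
      Den Γ (.box Δ Ns V) (.box τ) (fun ρ k => F ρ (fun B => k (boxD v B)))
/-- The denotation of a list of box arguments. -/
inductive DenL : Cx P → List (Tm P C) → List (Ty P) →
    (Env P → (((Env P → ℕ) → ℕ) → ℕ) → ℕ) → Prop
  | nil {Γ : Cx P} : DenL Γ [] [] (fun _ k => k (fun κ => κ dEnv))
  | cons {Γ : Cx P} {σ : Ty P} {Δ : List (Ty P)} {N : Tm P C} {Ns : List (Tm P C)}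
      {f : Env P → (Dom (.box σ) → ℕ) → ℕ} {F : Env P → (((Env P → ℕ) → ℕ) → ℕ) → ℕ} :
      Den Γ N (.box σ) f → DenL Γ Ns Δ F →
      DenL Γ (N :: Ns) (σ :: Δ)
        (fun ρ k => f ρ (fun b => F ρ (fun B => k (consB b B)) + cost N b))
end

-- Graded relations on denotations, congruence and strict monotonicity.

/-- Environments that are related on the variables of `Γ`. -/
def ERel (Γ : Cx P) (ρ ρ' : Env P) : Prop :=
  ∀ i τ, Γ i = some τ → Dom.Rel τ 0 (ρ i τ) (ρ' i τ)

/-- The graded relation on denotations of terms. -/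
def SRel (Γ : Cx P) {τ : Ty P} (s : ℕ) (f g : Env P → (Dom τ → ℕ) → ℕ) : Prop :=
  ∀ ρ ρ' u k l, ERel Γ ρ ρ' → Dom.KRel τ u k l → f ρ k + s + u ≤ g ρ' l

/-- The graded relation on tuples of box values. -/
def BRel (Δ : Cx P) (s : ℕ) (A B : (Env P → ℕ) → ℕ) : Prop :=
  ∀ u κ μ, (∀ e e', ERel Δ e e' → κ e + u ≤ μ e') → A κ + s + u ≤ B μ

/-- The relation on continuations that belongs to `BRel`. -/
def BKRel (Δ : Cx P) (u : ℕ) (k l : ((Env P → ℕ) → ℕ) → ℕ) : Prop :=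
  ∀ t A B, BRel Δ t A B → k A + u + t ≤ l B

/-- The graded relation on denotations of lists of box arguments. -/
def LRel (Γ Δ : Cx P) (s : ℕ) (F G : Env P → (((Env P → ℕ) → ℕ) → ℕ) → ℕ) : Prop :=
  ∀ ρ ρ' u k l, ERel Γ ρ ρ' → BKRel Δ u k l → F ρ k + s + u ≤ G ρ' l

/-- Environments are compared at gap 0 only, so the gap `t` is forgotten here; the measure charged
by `absD` and `consB` gives it back. -/
theorem ERel.scons {Γ : Cx P} {ρ ρ' : Env P} (h : ERel Γ ρ ρ') {σ : Ty P} {t : ℕ} {a b : Dom σ}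
    (hab : Dom.Rel σ t a b) :
    ERel (scons (some σ) Γ) (scons (Dom.inj a) ρ) (scons (Dom.inj b) ρ') := by
  intro i τ hi
  cases i with
  | zero =>
    obtain rfl : σ = τ := by simpa using hi
    simpa using hab.mono (Nat.zero_le _)
  | succ i => exact h i τ hi

theorem BRel.consB {σ : Ty P} {Δ : List (Ty P)} {s t : ℕ} {b b' : Dom (.box σ)}
    {B B' : (Env P → ℕ) → ℕ} (hb : Dom.Rel (.box σ) s b b') (hB : BRel (cx Δ) t B B') :
    BRel (cx (σ :: Δ)) (s + t) (consB b B) (consB b' B') := by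
  intro u κ μ hκ
  have : Dom.KRel σ (t + u)
      (fun x => B (fun e => κ (_root_.scons (Dom.inj x) e)) + Dom.meas σ x)
      (fun x => B' (fun e => μ (_root_.scons (Dom.inj x) e)) + Dom.meas σ x) := by
    intro w c d hcd
    have h1 := Dom.meas_rel hcd
    have h2 := hB u (fun e => κ (_root_.scons (Dom.inj c) e))
      (fun e => μ (_root_.scons (Dom.inj d) e))
      (fun e e' he => hκ _ _ (cx_cons σ Δ ▸ he.scons hcd))
    simp only
    omega
  have := hb.box this
  simp only [Tm.consB]
  omega

/-- The implication between values is the direction in which reduction goes: a step may create a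
value and so remove a charge, but never the converse. -/
theorem cost_rel {M N : Tm P C} {τ : Ty P} (h : IsValue M → IsValue N) {s : ℕ} {a b : Dom τ}
    (hab : Dom.Rel τ s a b) : cost N a ≤ cost M b := by
  have := Dom.meas_rel hab
  by_cases hM : IsValue M
  · simp [cost_value hM, cost_value (h hM)]
  · rw [cost_not hM]
    by_cases hN : IsValue N
    · simp [cost_value hN]
    · rw [cost_not hN]; omega

theorem SRel.lam {Γ : Cx P} {σ τ : Ty P} {s : ℕ} {f g : Env P → (Dom τ → ℕ) → ℕ}
    (h : SRel (scons (some σ) Γ) s f g) :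
    SRel Γ (τ := .arr σ τ) s (fun ρ k => k (absD f ρ)) (fun ρ k => k (absD g ρ)) := by
  intro ρ ρ' u k l hρ hk
  have : Dom.Rel (.arr σ τ) s (absD f ρ) (absD g ρ') := by
    intro t u a b k l hab hk
    have h1 := h _ _ u k l (hρ.scons hab) hk
    -- The measure charged by `absD` supplies the gap `t` that the environment has lost.
    have h2 := Dom.meas_rel hab
    simp only [absD]
    omega
  have := hk _ _ _ this
  simp only
  omega

theorem SRel.app {Γ : Cx P} {σ τ : Ty P} {s t : ℕ} {M N : Tm P C}
    {f f' : Env P → (Dom (.arr σ τ) → ℕ) → ℕ} {g g' : Env P → (Dom σ → ℕ) → ℕ}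
    (hf : SRel Γ s f f') (hg : SRel Γ t g g') (hv : IsValue M → IsValue N) :
    SRel Γ (s + t) (fun ρ k => f ρ (fun φ => g ρ (fun a => φ a k) + cost N φ))
      (fun ρ k => f' ρ (fun φ => g' ρ (fun a => φ a k) + cost M φ)) := by
  intro ρ ρ' u k l hρ hk
  have : Dom.KRel (.arr σ τ) (t + u) (fun φ => g ρ (fun a => φ a k) + cost N φ)
      (fun φ => g' ρ' (fun a => φ a l) + cost M φ) := by
    intro w φ ψ h
    have h1 := cost_rel hv h
    have h2 := hg ρ ρ' (u + w) (fun a => φ a k) (fun a => ψ a l) hρ (by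
      intro t a b hab
      have := h.arr hab hk
      simp only
      omega)
    simp only
    omega
  have := hf ρ ρ' _ _ _ hρ this
  simp only
  omega

theorem SRel.box {Γ : Cx P} {Δ : List (Ty P)} {τ : Ty P} {s t : ℕ}
    {F F' : Env P → (((Env P → ℕ) → ℕ) → ℕ) → ℕ} {v v' : Env P → Dom τ}
    (hF : LRel Γ (cx Δ) s F F') (hv : SRel (cx Δ) t (fun e k => k (v e)) (fun e k => k (v' e))) :
    SRel Γ (τ := .box τ) (s + t) (fun ρ k => F ρ (fun B => k (boxD v B)))
      (fun ρ k => F' ρ (fun B => k (boxD v' B))) := by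
  intro ρ ρ' u k l hρ hk
  have : BKRel (cx Δ) (t + u) (fun B => k (boxD v B)) (fun B => l (boxD v' B)) := by
    intro w A B h
    have : Dom.Rel (.box τ) (t + w) (boxD v A) (boxD v' B) := by
      intro x κ μ hκ
      have := h (t + x) (fun e => κ (v e)) (fun e => μ (v' e)) (by
        intro e e' he
        have := hv e e' x κ μ he hκ
        simp only at this ⊢
        omega)
      simp only [boxD]
      omega
    have := hk _ _ _ this
    simp only
    omega
  have := hF ρ ρ' _ _ _ hρ this
  simp only
  omega

theorem LRel.nil {Γ : Cx P} :
    LRel Γ (cx []) 0 (fun _ k => k (fun κ => κ dEnv)) (fun _ k => k (fun κ => κ dEnv)) := by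
  intro ρ ρ' u k l _ hk
  have := hk 0 (fun κ => κ dEnv) (fun κ => κ dEnv) (by
    intro u κ μ h
    exact h _ _ (fun i τ hi => by simp [cx] at hi))
  simp only
  omega

theorem LRel.cons {Γ : Cx P} {Δ : List (Ty P)} {σ : Ty P} {s t : ℕ} {M N : Tm P C}
    {F F' : Env P → (((Env P → ℕ) → ℕ) → ℕ) → ℕ} {f f' : Env P → (Dom (.box σ) → ℕ) → ℕ}
    (hf : SRel Γ s f f') (hF : LRel Γ (cx Δ) t F F') (hv : IsValue M → IsValue N) :
    LRel Γ (cx (σ :: Δ)) (s + t)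
      (fun ρ k => f ρ (fun b => F ρ (fun B => k (consB b B)) + cost N b))
      (fun ρ k => f' ρ (fun b => F' ρ (fun B => k (consB b B)) + cost M b)) := by
  intro ρ ρ' u k l hρ hk
  have : Dom.KRel (.box σ) (t + u) (fun b => F ρ (fun B => k (consB b B)) + cost N b)
      (fun b => F' ρ' (fun B => l (consB b B)) + cost M b) := by
    intro w b b' h
    have h1 := cost_rel hv h
    have h2 := hF ρ ρ' (u + w) (fun B => k (consB b B)) (fun B => l (consB b' B)) hρ (by
      intro t A B hAB
      have := hk _ _ _ (BRel.consB h hAB)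
      simp only
      omega)
    simp only
    omega
  have := hf ρ ρ' _ _ _ hρ this
  simp only
  omega

mutual
/-- Denotations are strictly monotone. -/
theorem Den.self {Γ : Cx P} {M : Tm P C} {τ : Ty P} {f : Env P → (Dom τ → ℕ) → ℕ} :
    Den Γ M τ f → SRel Γ 0 f f
  | .const c τ => fun ρ ρ' u k l _ hk => by
      have := hk _ _ _ (Dom.base_rel τ).1
      simp only
      omega
  | .var hi => fun ρ ρ' u k l hρ hk => by
      have := hk _ _ _ (hρ _ _ hi)
      simp only
      omega
  | .lam h => SRel.lam h.self
  | .app hf hg => SRel.app hf.self hg.self id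
  | .box hF _ h => SRel.box hF.self h.self
theorem DenL.self {Γ : Cx P} {Ns : List (Tm P C)} {Δ : List (Ty P)}
    {F : Env P → (((Env P → ℕ) → ℕ) → ℕ) → ℕ} : DenL Γ Ns Δ F → LRel Γ (cx Δ) 0 F F
  | .nil => LRel.nil
  | .cons hf hF => LRel.cons hf.self hF.self id
end

-- Renaming of denotations, in both directions.

/-- Induction on terms, with an induction hypothesis for each argument of a box. -/
theorem induct {p : Tm P C → Prop} (hconst : ∀ c τ, p (const c τ)) (hvar : ∀ i, p (var i))
    (hlam : ∀ σ M, p M → p (lam σ M)) (happ : ∀ M N, p M → p N → p (app M N))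
    (hbox : ∀ Δ Ns M, (∀ N ∈ Ns, p N) → p M → p (box Δ Ns M)) (M : Tm P C) : p M :=
  Tm.rec (motive_1 := p) (motive_2 := fun Ns => ∀ N ∈ Ns, p N) hconst hvar hlam happ hbox
    (fun _ h => absurd h List.not_mem_nil)
    (fun _ _ h hs _ hN => (List.mem_cons.1 hN).elim (fun e => e ▸ h) (hs _)) M

theorem renameList_eq (r : ℕ → ℕ) (Ns : List (Tm P C)) : renameList r Ns = Ns.map (rename r) := by
  induction Ns with
  | nil => rfl
  | cons N Ns ih => simp [renameList, ih]

theorem substList_eq (s : ℕ → Tm P C) (Ns : List (Tm P C)) : substList s Ns = Ns.map (subst s) := by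
  induction Ns with
  | nil => rfl
  | cons N Ns ih => simp [substList, ih]

theorem not_isValue_app (M N : Tm P C) : ¬ IsValue (app M N) := fun h => by cases h

theorem isValue_box {Δ : List (Ty P)} {Ns : List (Tm P C)} {M : Tm P C} :
    IsValue (box Δ Ns M) ↔ ∀ N ∈ Ns, IsValue N :=
  ⟨fun h => by cases h; assumption, .box _ _ _⟩

theorem isValue_rename (r : ℕ → ℕ) (M : Tm P C) : IsValue (rename r M) ↔ IsValue M := by
  induction M using induct with
  | hconst c τ => rw [rename]
  | hvar i => rw [rename]; exact ⟨fun _ => .var _, fun _ => .var _⟩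
  | hlam σ M _ => rw [rename]; exact ⟨fun _ => .lam _ _, fun _ => .lam _ _⟩
  | happ M N _ _ => rw [rename]; simp [not_isValue_app]
  | hbox Δ Ns M h _ =>
    rw [rename, renameList_eq, isValue_box, isValue_box, List.forall_mem_map]
    exact forall₂_congr h

theorem isValue_subst {s : ℕ → Tm P C} (hs : ∀ i, IsValue (s i)) (M : Tm P C) :
    IsValue (subst s M) ↔ IsValue M := by
  induction M using induct with
  | hconst c τ => rw [subst]
  | hvar i => rw [subst]; exact ⟨fun _ => .var _, fun _ => hs i⟩
  | hlam σ M _ => rw [subst]; exact ⟨fun _ => .lam _ _, fun _ => .lam _ _⟩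
  | happ M N _ _ => rw [subst]; simp [not_isValue_app]
  | hbox Δ Ns M h _ =>
    rw [subst, substList_eq, isValue_box, isValue_box, List.forall_mem_map]
    exact forall₂_congr h

theorem cost_congr {M N : Tm P C} (h : IsValue M ↔ IsValue N) {τ : Ty P} (a : Dom τ) :
    cost M a = cost N a := by
  by_cases hN : IsValue N
  · rw [cost_value (h.2 hN), cost_value hN]
  · rw [cost_not (mt h.1 hN), cost_not hN]

theorem scons_upRen {A : Type*} (a : A) (f : ℕ → A) (r : ℕ → ℕ) :
    (fun i => scons a f (upRen r i)) = scons a (fun i => f (r i)) := by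
  funext i; cases i <;> rfl

theorem absD_upRen {σ τ : Ty P} (f : Env P → (Dom τ → ℕ) → ℕ) (r : ℕ → ℕ) (ρ : Env P) :
    absD (σ := σ) (fun ρ => f (fun i => ρ (upRen r i))) ρ = absD f (fun i => ρ (r i)) := by
  funext a k
  simp only [absD, scons_upRen]

mutual
/-- Denotation of a renamed term. -/
theorem Den.rename {Γ Γ' : Cx P} {r : ℕ → ℕ} {M : Tm P C} {τ : Ty P}
    {f : Env P → (Dom τ → ℕ) → ℕ} (hr : ∀ i σ, Γ i = some σ → Γ' (r i) = some σ) :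
    Den Γ M τ f → Den Γ' (Tm.rename r M) τ (fun ρ => f (fun i => ρ (r i)))
  | .const c τ => by rw [Tm.rename]; exact .const c τ
  | .var hi => by rw [Tm.rename]; exact .var (hr _ _ hi)
  | .lam (σ := σ) (f := f) h => by
      have := Den.lam (h.rename (Γ' := scons (some σ) Γ') (r := upRen r) (by
        intro i; cases i with
        | zero => exact fun _ h => h
        | succ i => exact hr i))
      simp only [absD_upRen] at this
      rw [Tm.rename]; exact this
  | .app (M := M) hf hg => by
      have := Den.app (hf.rename hr) (hg.rename hr)
      simp only [cost_congr (isValue_rename r M)] at this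
      rw [Tm.rename]; exact this
  | .box hF hV h => by
      rw [Tm.rename]
      exact Den.box (hF.rename hr) hV h
/-- Denotation of a renamed list of box arguments. -/
theorem DenL.rename {Γ Γ' : Cx P} {r : ℕ → ℕ} {Ns : List (Tm P C)} {Δ : List (Ty P)}
    {F : Env P → (((Env P → ℕ) → ℕ) → ℕ) → ℕ} (hr : ∀ i σ, Γ i = some σ → Γ' (r i) = some σ) :
    DenL Γ Ns Δ F → DenL Γ' (renameList r Ns) Δ (fun ρ => F (fun i => ρ (r i)))
  | .nil => by rw [renameList]; exact .nil
  | .cons (N := N) hf hF => by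
      have := DenL.cons (hf.rename hr) (hF.rename hr)
      simp only [cost_congr (isValue_rename r N)] at this
      rw [renameList]; exact this
end

mutual
/-- A denotation of a renamed term comes from one of the term itself. -/
theorem Den.of_rename {Γ : Cx P} {r : ℕ → ℕ} : ∀ (M : Tm P C) {τ : Ty P}
    {f : Env P → (Dom τ → ℕ) → ℕ}, Den Γ (Tm.rename r M) τ f →
    ∃ g, Den (fun i => Γ (r i)) M τ g ∧ f = fun ρ => g (fun i => ρ (r i))
  | .const c τ, _, _, h => by
      rw [Tm.rename] at h; cases h; exact ⟨_, .const c τ, rfl⟩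
  | .var i, _, _, h => by
      rw [Tm.rename] at h; cases h with | var h => exact ⟨_, .var h, rfl⟩
  | .lam σ M, _, _, h => by
      rw [Tm.rename] at h
      cases h with
      | lam h =>
        obtain ⟨g, hg, rfl⟩ := Den.of_rename M h
        rw [scons_upRen] at hg
        exact ⟨_, .lam hg, by simp only [absD_upRen]⟩
  | .app M N, _, _, h => by
      rw [Tm.rename] at h
      cases h with
      | app h1 h2 =>
        obtain ⟨f, hf, rfl⟩ := Den.of_rename M h1
        obtain ⟨g, hg, rfl⟩ := Den.of_rename N h2
        exact ⟨_, .app hf hg, by simp only [cost_congr (isValue_rename r M)]⟩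
  | .box Δ Ns V, _, _, h => by
      rw [Tm.rename] at h
      cases h with
      | box h1 hV h2 =>
        obtain ⟨F, hF, rfl⟩ := DenL.of_rename Ns h1
        exact ⟨_, .box hF hV h2, rfl⟩
/-- A denotation of a renamed list of box arguments comes from one of the list itself. -/
theorem DenL.of_rename {Γ : Cx P} {r : ℕ → ℕ} : ∀ (Ns : List (Tm P C)) {Δ : List (Ty P)}
    {F : Env P → (((Env P → ℕ) → ℕ) → ℕ) → ℕ}, DenL Γ (renameList r Ns) Δ F →
    ∃ G, DenL (fun i => Γ (r i)) Ns Δ G ∧ F = fun ρ => G (fun i => ρ (r i))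
  | [], _, _, h => by
      rw [renameList] at h; cases h; exact ⟨_, .nil, rfl⟩
  | N :: Ns, _, _, h => by
      rw [renameList] at h
      cases h with
      | cons h1 h2 =>
        obtain ⟨f, hf, rfl⟩ := Den.of_rename N h1
        obtain ⟨G, hG, rfl⟩ := DenL.of_rename Ns h2
        exact ⟨_, .cons hf hG, by simp only [cost_congr (isValue_rename r N)]⟩
end

theorem isValue_shift (M : Tm P C) : IsValue M.shift ↔ IsValue M := isValue_rename _ M

theorem Den.shift {Γ : Cx P} {a : Option (Ty P)} {M : Tm P C} {τ : Ty P}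
    {f : Env P → (Dom τ → ℕ) → ℕ} (h : Den Γ M τ f) :
    Den (scons a Γ) M.shift τ (fun ρ => f (fun i => ρ (Nat.succ i))) :=
  h.rename fun _ _ h => h

theorem Den.of_shift {Γ : Cx P} {a : Option (Ty P)} {M : Tm P C} {τ : Ty P}
    {f : Env P → (Dom τ → ℕ) → ℕ} (h : Den (scons a Γ) M.shift τ f) :
    ∃ g, Den Γ M τ g ∧ f = fun ρ => g (fun i => ρ (Nat.succ i)) :=
  Den.of_rename (Γ := scons a Γ) M h

-- Values and substitution.

/-- Values denote elements of the domain. -/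
theorem Den.exists_value {Γ : Cx P} {V : Tm P C} {τ : Ty P} {f : Env P → (Dom τ → ℕ) → ℕ}
    (h : Den Γ V τ f) (hV : IsValue V) : ∃ v : Env P → Dom τ, f = fun ρ k => k (v ρ) := by
  suffices H : ∀ V : Tm P C, IsValue V → ∀ Γ τ (f : Env P → (Dom τ → ℕ) → ℕ), Den Γ V τ f →
      ∃ v : Env P → Dom τ, f = fun ρ k => k (v ρ) from H V hV Γ τ f h
  clear h hV
  intro V
  induction V using induct with
  | hconst c τ => intro _ Γ τ f h; cases h; exact ⟨_, rfl⟩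
  | hvar i => intro _ Γ τ f h; cases h; exact ⟨_, rfl⟩
  | hlam σ M _ => intro _ Γ τ f h; cases h; exact ⟨_, rfl⟩
  | happ M N _ _ => intro h; cases h
  | hbox Δ Ns M ih _ =>
    intro hV Γ τ f h
    rw [isValue_box] at hV
    cases h with
    | box hF hM h =>
      rename_i F v
      suffices H : ∃ B : Env P → (Env P → ℕ) → ℕ, F = fun ρ k => k (B ρ) by
        obtain ⟨B, rfl⟩ := H
        exact ⟨_, rfl⟩
      clear hM h v
      induction Ns generalizing Δ F with
      | nil => cases hF; exact ⟨_, rfl⟩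
      | cons N Ns ihNs =>
        cases hF with
        | cons h1 h2 =>
          obtain ⟨b, rfl⟩ := ih N (by simp) (hV N (by simp)) _ _ _ h1
          obtain ⟨B, rfl⟩ := ihNs _ (fun N hN => ih N (by simp [hN]))
            (fun N hN => hV N (by simp [hN])) h2
          exact ⟨fun ρ => consB (b ρ) (B ρ), by simp [cost_value (hV N (by simp))]⟩

theorem DenL.exists_value {Γ : Cx P} {Vs : List (Tm P C)} {Δ : List (Ty P)}
    {F : Env P → (((Env P → ℕ) → ℕ) → ℕ) → ℕ}
    (h : DenL Γ Vs Δ F) (hV : ∀ V ∈ Vs, IsValue V) :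
    ∃ B : Env P → (Env P → ℕ) → ℕ, F = fun ρ k => k (B ρ) := by
  induction Vs generalizing Δ F with
  | nil => cases h; exact ⟨_, rfl⟩
  | cons N Ns ih =>
    cases h with
    | cons h1 h2 =>
      obtain ⟨b, rfl⟩ := h1.exists_value (hV N (by simp))
      obtain ⟨B, rfl⟩ := ih h2 fun N hN => hV N (by simp [hN])
      exact ⟨fun ρ => consB (b ρ) (B ρ), by simp [cost_value (hV N (by simp))]⟩

theorem isValue_upSub {s : ℕ → Tm P C} (hs : ∀ i, IsValue (s i)) (i : ℕ) :
    IsValue (upSub s i) := by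
  cases i with
  | zero => exact .var 0
  | succ i => exact (isValue_shift _).2 (hs i)

mutual
/-- Denotation of the substitution of values. -/
theorem Den.subst {Γ Γ' : Cx P} {s : ℕ → Tm P C} {w : Env P → Env P} {M : Tm P C} {τ : Ty P}
    {f : Env P → (Dom τ → ℕ) → ℕ} (hv : ∀ i, IsValue (s i))
    (hs : ∀ i σ, Γ i = some σ → Den Γ' (s i) σ (fun ρ k => k (w ρ i σ))) :
    Den Γ M τ f → Den Γ' (Tm.subst s M) τ (fun ρ => f (w ρ))
  | .const c τ => by rw [Tm.subst]; exact .const c τ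
  | .var hi => by rw [Tm.subst]; exact hs _ _ hi
  | .lam (σ := σ) (f := f) h => by
      have := Den.lam (h.subst (Γ' := scons (some σ) Γ') (isValue_upSub hv)
        -- Entry 0 is the bound variable; the remaining entries are computed from the environment
        -- outside the abstraction.
        (w := fun ρ => scons (ρ 0) (w (fun i => ρ (Nat.succ i)))) (by
          intro i; cases i with
          | zero => exact fun τ h => .var h
          | succ i => exact fun τ h => (hs i τ h).shift))
      rw [Tm.subst]; exact this
  | .app (M := M) hf hg => by
      have := Den.app (hf.subst hv hs) (hg.subst hv hs)
      simp only [cost_congr (isValue_subst hv M)] at this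
      rw [Tm.subst]; exact this
  | .box hF hV h => by
      rw [Tm.subst]
      exact Den.box (hF.subst hv hs) hV h
/-- Denotation of the substitution of values in a list of box arguments. -/
theorem DenL.subst {Γ Γ' : Cx P} {s : ℕ → Tm P C} {w : Env P → Env P} {Ns : List (Tm P C)}
    {Δ : List (Ty P)} {F : Env P → (((Env P → ℕ) → ℕ) → ℕ) → ℕ} (hv : ∀ i, IsValue (s i))
    (hs : ∀ i σ, Γ i = some σ → Den Γ' (s i) σ (fun ρ k => k (w ρ i σ))) :
    DenL Γ Ns Δ F → DenL Γ' (substList s Ns) Δ (fun ρ => F (w ρ))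
  | .nil => by rw [substList]; exact .nil
  | .cons (N := N) hf hF => by
      have := DenL.cons (hf.subst hv hs) (hF.subst hv hs)
      simp only [cost_congr (isValue_subst hv N)] at this
      rw [substList]; exact this
end

-- Concatenation of box arguments.

theorem catB_cons {σ : Ty P} (m : ℕ) (b : Dom (.box σ)) (A B : (Env P → ℕ) → ℕ) :
    catB (m + 1) (consB b A) B = consB b (catB m A B) := by
  funext κ
  simp only [catB, consB, scat_succ]

theorem catB_nil (B : (Env P → ℕ) → ℕ) : catB 0 (fun κ => κ dEnv) B = B := by
  funext κ
  simp only [catB, scat_zero]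

theorem DenL.append {Γ : Cx P} {Ls Ns : List (Tm P C)} {Δ Θ : List (Ty P)}
    {F G : Env P → (((Env P → ℕ) → ℕ) → ℕ) → ℕ} (hF : DenL Γ Ls Δ F) (hG : DenL Γ Ns Θ G) :
    DenL Γ (Ls ++ Ns) (Δ ++ Θ) (fun ρ k => F ρ (fun A => G ρ (fun B => k (catB Δ.length A B)))) := by
  induction Ls generalizing Δ F with
  | nil =>
    cases hF
    simpa [catB_nil] using hG
  | cons L Ls ih =>
    cases hF with
    | cons h1 h2 =>
      have := DenL.cons h1 (ih h2)
      simp only [← catB_cons] at this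
      exact this

theorem DenL.length_eq {Γ : Cx P} {Ns : List (Tm P C)} {Δ : List (Ty P)}
    {F : Env P → (((Env P → ℕ) → ℕ) → ℕ) → ℕ} (h : DenL Γ Ns Δ F) : Ns.length = Δ.length := by
  induction Ns generalizing Δ F with
  | nil => cases h; rfl
  | cons N Ns ih => cases h with | cons h1 h2 => simp [ih h2]

theorem DenL.of_append {Γ : Cx P} {Ls Ns : List (Tm P C)} {Ξ : List (Ty P)}
    {H : Env P → (((Env P → ℕ) → ℕ) → ℕ) → ℕ} (h : DenL Γ (Ls ++ Ns) Ξ H) :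
    ∃ Δ Θ F G, Ξ = Δ ++ Θ ∧ DenL Γ Ls Δ F ∧ DenL Γ Ns Θ G ∧
      H = fun ρ k => F ρ (fun A => G ρ (fun B => k (catB Δ.length A B))) := by
  induction Ls generalizing Ξ H with
  | nil => exact ⟨[], Ξ, _, H, rfl, .nil, h, by simp [catB_nil]⟩
  | cons L Ls ih =>
    cases h with
    | cons h1 h2 =>
      obtain ⟨Δ, Θ, F, G, rfl, hF, hG, rfl⟩ := ih h2
      exact ⟨_, Θ, _, G, rfl, .cons h1 hF, hG, by simp only [List.length_cons, catB_cons]⟩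

theorem ERel.scat {Δ Θ : List (Ty P)} {e₁ e₁' e₂ e₂' : Env P} (h₁ : ERel (cx Δ) e₁ e₁')
    (h₂ : ERel (cx Θ) e₂ e₂') :
    ERel (cx (Δ ++ Θ)) (scat Δ.length e₁ e₂) (scat Δ.length e₁' e₂') := by
  intro i τ hi
  simp only [cx, List.getElem?_append] at hi
  by_cases h : i < Δ.length
  · simp only [_root_.scat, h, if_true] at hi ⊢
    exact h₁ i τ hi
  · simp only [_root_.scat, h, if_false] at hi ⊢
    exact h₂ _ τ hi

theorem BRel.catB {Δ Θ : List (Ty P)} {s t : ℕ} {A A' B B' : (Env P → ℕ) → ℕ}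
    (hA : BRel (cx Δ) s A A') (hB : BRel (cx Θ) t B B') :
    BRel (cx (Δ ++ Θ)) (s + t) (catB Δ.length A B) (catB Δ.length A' B') := by
  intro u κ μ h
  have := hA (t + u) (fun e => B (fun e' => κ (_root_.scat Δ.length e e')))
    (fun e => B' (fun e' => μ (_root_.scat Δ.length e e'))) (by
    intro e₁ e₁' h₁
    have := hB u _ _ (fun e₂ e₂' h₂ => h _ _ (h₁.scat h₂))
    omega)
  simp only [Tm.catB]
  omega

theorem LRel.append {Γ : Cx P} {Δ Θ : List (Ty P)} {s t : ℕ}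
    {F F' G G' : Env P → (((Env P → ℕ) → ℕ) → ℕ) → ℕ} (hF : LRel Γ (cx Δ) s F F')
    (hG : LRel Γ (cx Θ) t G G') :
    LRel Γ (cx (Δ ++ Θ)) (s + t)
      (fun ρ k => F ρ (fun A => G ρ (fun B => k (catB Δ.length A B))))
      (fun ρ k => F' ρ (fun A => G' ρ (fun B => k (catB Δ.length A B)))) := by
  intro ρ ρ' u k l hρ hk
  have := hF ρ ρ' (t + u) (fun A => G ρ (fun B => k (Tm.catB Δ.length A B)))
    (fun A => G' ρ' (fun B => l (Tm.catB Δ.length A B))) hρ (by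
    intro w A A' hA
    have := hG ρ ρ' (u + w) (fun B => k (Tm.catB Δ.length A B))
      (fun B => l (Tm.catB Δ.length A' B)) hρ (by
      intro x B B' hB
      have := hk _ _ _ (hA.catB hB)
      simp only
      omega)
    simp only
    omega)
  simp only
  omega

theorem Den.self_value {Γ : Cx P} {V : Tm P C} {τ : Ty P} {v : Env P → Dom τ}
    (h : Den Γ V τ (fun ρ k => k (v ρ))) {ρ ρ' : Env P} (hρ : ERel Γ ρ ρ') :
    Dom.Rel τ 0 (v ρ) (v ρ') :=
  Dom.Rel.of_forall fun u k l hk => h.self ρ ρ' u k l hρ hk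

-- Frames and evaluation contexts as transformers of continuations.

open Classical in
/-- The price for evaluating `M` in the hole of a frame. -/
noncomputable def price (F : Frame P C) (M : Tm P C) {τ : Ty P} (a : Dom τ) : ℕ :=
  if F.IsAppR then 0 else cost M a

theorem price_appL (N M : Tm P C) {τ : Ty P} (a : Dom τ) : price (.appL N) M a = cost M a :=
  if_neg id

theorem price_appR (N M : Tm P C) {τ : Ty P} (a : Dom τ) : price (.appR N) M a = 0 :=
  if_pos trivial

theorem price_box (Δ : List (Ty P)) (Ls Ns : List (Tm P C)) (V M : Tm P C) {τ : Ty P}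
    (a : Dom τ) : price (.box Δ Ls Ns V) M a = cost M a :=
  if_neg id

/-- `FDen Γ F σ τ K`: the simple frame `F` with a hole of type `σ` has type `τ`, and extends
continuations by `K`. -/
inductive FDen (Γ : Cx P) : Frame P C → (σ τ : Ty P) →
    (Env P → (Dom τ → ℕ) → Dom σ → ℕ) → Prop
  | appL {σ τ : Ty P} {N : Tm P C} {g : Env P → (Dom σ → ℕ) → ℕ} : Den Γ N σ g →
      FDen Γ (.appL N) (.arr σ τ) τ (fun ρ k φ => g ρ (fun a => φ a k))
  | appR {σ τ : Ty P} {V : Tm P C} {v : Env P → Dom (.arr σ τ)} : IsValue V →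
      Den Γ V (.arr σ τ) (fun ρ k => k (v ρ)) → FDen Γ (.appR V) σ τ (fun ρ k a => v ρ a k)
  | box {Δ Θ : List (Ty P)} {σ τ : Ty P} {Ls Ns : List (Tm P C)} {V : Tm P C}
      {B : Env P → (Env P → ℕ) → ℕ} {G : Env P → (((Env P → ℕ) → ℕ) → ℕ) → ℕ}
      {v : Env P → Dom τ} : (∀ L ∈ Ls, IsValue L) → DenL Γ Ls Δ (fun ρ k => k (B ρ)) →
      DenL Γ Ns Θ G → IsValue V → Den (cx (Δ ++ σ :: Θ)) V τ (fun e k => k (v e)) →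
      FDen Γ (.box (Δ ++ σ :: Θ) Ls Ns V) (.box σ) (.box τ)
        (fun ρ k b => G ρ (fun D => k (boxD v (catB Δ.length (B ρ) (consB b D)))))

/-- In a simple frame everything to the left of the hole is a value and returns at once, so the
content of the hole is what runs first. The rest of the frame becomes part of its continuation. -/
theorem FDen.of_plug {Γ : Cx P} {F : Frame P C} {M : Tm P C} {τ : Ty P}
    {f : Env P → (Dom τ → ℕ) → ℕ} (hF : F.IsSimple) (h : Den Γ (F.plug M) τ f) :
    ∃ σ K g, FDen Γ F σ τ K ∧ Den Γ M σ g ∧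
      f = fun ρ k => g ρ (fun a => K ρ k a + price F M a) := by
  cases F with
  | appL N =>
    cases h with
    | app hM hN => exact ⟨_, _, _, .appL hN, hM, by simp only [price_appL]⟩
  | appR V =>
    cases h with
    | app hV hM =>
      obtain ⟨v, rfl⟩ := hV.exists_value hF
      exact ⟨_, _, _, .appR hF hV, hM, by simp only [price_appR, cost_value hF, Nat.add_zero]⟩
  | box Δ Ls Ns V =>
    cases h with
    | box hN hV h =>
      obtain ⟨Δ, Θ, F, G, rfl, h1, h2, rfl⟩ := hN.of_append
      obtain ⟨B, rfl⟩ := h1.exists_value hF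
      cases h2 with
      | cons hM h2 =>
        exact ⟨_, _, _, .box hF h1 h2 hV h, hM, by simp only [price_box]⟩

theorem FDen.plug {Γ : Cx P} {F : Frame P C} {M : Tm P C} {σ τ : Ty P}
    {K : Env P → (Dom τ → ℕ) → Dom σ → ℕ} {g : Env P → (Dom σ → ℕ) → ℕ}
    (hF : FDen Γ F σ τ K) (h : Den Γ M σ g) :
    Den Γ (F.plug M) τ (fun ρ k => g ρ (fun a => K ρ k a + price F M a)) := by
  cases hF with
  | appL hN =>
    simp only [price_appL]
    exact h.app hN
  | appR hV hv =>
    have := hv.app h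
    simp only [cost_value hV] at this
    simp only [price_appR]
    exact this
  | box hL hB hG hV hv =>
    simp only [price_box]
    exact Den.box (hB.append (.cons h hG)) hV hv

theorem map_shift (Ns : List (Tm P C)) : Ns.map shift = renameList Nat.succ Ns :=
  (renameList_eq _ _).symm

theorem FDen.shift {Γ : Cx P} {a : Option (Ty P)} {F : Frame P C} {σ τ : Ty P}
    {K : Env P → (Dom τ → ℕ) → Dom σ → ℕ} (h : FDen Γ F σ τ K) :
    FDen (scons a Γ) F.shift σ τ (fun ρ => K (fun i => ρ (Nat.succ i))) := by
  cases h with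
  | appL hN => exact .appL hN.shift
  | appR hV hv => exact .appR ((isValue_shift _).2 hV) hv.shift
  | box hL hB hG hV hv =>
    rw [Frame.shift, map_shift, map_shift]
    refine .box ?_ (DenL.rename (r := Nat.succ) (Γ' := scons a Γ) (fun _ _ h => h) hB)
      (DenL.rename (r := Nat.succ) (Γ' := scons a Γ) (fun _ _ h => h) hG) hV hv
    rw [renameList_eq, List.forall_mem_map]
    exact fun L h => (isValue_rename _ _).2 (hL L h)

theorem isSimple_shift (F : Frame P C) : F.shift.IsSimple ↔ F.IsSimple := by
  cases F with
  | appL N => exact Iff.rfl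
  | appR V => exact isValue_shift V
  | box Δ Ls Ns V =>
    rw [Frame.shift, Frame.IsSimple, Frame.IsSimple, List.forall_mem_map]
    exact forall₂_congr fun L _ => isValue_shift L

/-- A shifted frame cannot see the new variable, so its action on continuations depends only on the
old environment. This is what lets beta-Omega move the frames out of the abstraction. -/
theorem FDen.of_shift {Γ : Cx P} {a : Option (Ty P)} {F : Frame P C} {σ τ : Ty P}
    {K : Env P → (Dom τ → ℕ) → Dom σ → ℕ} (hF : F.IsSimple)
    (h : FDen (scons a Γ) F.shift σ τ K) :
    ∃ K', FDen Γ F σ τ K' ∧ K = fun ρ => K' (fun i => ρ (Nat.succ i)) := by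
  cases F with
  | appL N =>
    cases h with
    | appL hN =>
      obtain ⟨g, hg, rfl⟩ := hN.of_shift
      exact ⟨_, .appL hg, rfl⟩
  | appR V =>
    cases h with
    | appR hV hv =>
      rename_i v
      obtain ⟨g, hg, e⟩ := hv.of_shift
      obtain ⟨w, rfl⟩ := hg.exists_value hF
      refine ⟨_, .appR hF hg, ?_⟩
      funext ρ k x
      exact congrFun (congrFun e ρ) (fun φ => φ x k)
  | box Δ Ls Ns V =>
    rw [Frame.shift, map_shift, map_shift] at h
    cases h with
    | box hL hB hG hV hv =>
      obtain ⟨B, hB', e⟩ := DenL.of_rename (Γ := scons a Γ) _ hB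
      obtain ⟨G, hG', rfl⟩ := DenL.of_rename (Γ := scons a Γ) _ hG
      obtain ⟨B, rfl⟩ := hB'.exists_value hF
      refine ⟨_, .box hF hB' hG' hV hv, ?_⟩
      funext ρ k b
      congr 1
      funext D
      exact congrFun (congrFun e ρ)
        (fun A => k (boxD _ (Tm.catB _ A (consB b D))))

theorem FDen.self {Γ : Cx P} {F : Frame P C} {σ τ : Ty P}
    {K : Env P → (Dom τ → ℕ) → Dom σ → ℕ} (h : FDen Γ F σ τ K) {ρ ρ' : Env P} {u : ℕ}
    {k l : Dom τ → ℕ} (hρ : ERel Γ ρ ρ') (hk : Dom.KRel τ u k l) :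
    Dom.KRel σ u (K ρ k) (K ρ' l) := by
  cases h with
  | appL hN =>
    intro w φ ψ h
    have := hN.self ρ ρ' (u + w) (fun a => φ a k) (fun a => ψ a l) hρ (by
      intro t a b hab
      have := h.arr hab hk
      simp only
      omega)
    simp only
    omega
  | appR hV hv =>
    intro t a b hab
    have := (hv.self_value hρ).arr hab hk
    simp only
    omega
  | box hL hB hG hV hv =>
    rename_i Δ Θ σ τ Ls Ns V B G v
    intro t b b' hb
    have := hG.self ρ ρ' (u + t) (fun D => k (boxD v (Tm.catB Δ.length (B ρ) (Tm.consB b D))))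
      (fun D => l (boxD v (Tm.catB Δ.length (B ρ') (Tm.consB b' D)))) hρ (by
      intro w D D' hD
      have hBB : BRel (cx Δ) 0 (B ρ) (B ρ') := by
        intro u κ μ h
        exact hB.self ρ ρ' u (fun A => A κ) (fun A => A μ) hρ (by
          intro t A A' hA
          have := hA u κ μ h
          simp only
          omega)
      have hcat := hBB.catB (BRel.consB hb hD)
      have : Dom.Rel (.box τ) (t + w) (boxD v (Tm.catB Δ.length (B ρ) (Tm.consB b D)))
          (boxD v (Tm.catB Δ.length (B ρ') (Tm.consB b' D'))) := by
        intro x κ μ hκ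
        have := hcat x (fun e => κ (v e)) (fun e => μ (v e)) (by
          intro e e' he
          have := hκ _ _ _ (hv.self_value he)
          omega)
        simp only [boxD]
        omega
      have := hk _ _ _ this
      simp only
      omega)
    simp only
    omega

theorem not_isValue_plug (F : Frame P C) {M : Tm P C} (h : ¬ IsValue M) :
    ¬ IsValue (F.plug M) := by
  cases F with
  | appL N => exact not_isValue_app _ _
  | appR V => exact not_isValue_app _ _
  | box Δ Ls Ns V =>
    rw [Frame.plug, isValue_box]
    exact fun h' => h (h' M (by simp))

theorem not_isValue_plugs (E : List (Frame P C)) {M : Tm P C} (h : ¬ IsValue M) :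
    ¬ IsValue (Frame.plugs E M) := by
  induction E with
  | nil => exact h
  | cons F E ih => exact not_isValue_plug F ih

theorem price_not {F : Frame P C} {M N : Tm P C} (hM : ¬ IsValue M) (hN : ¬ IsValue N)
    {τ : Ty P} (a : Dom τ) : price F M a = price F N a := by
  simp [price, cost_not hM, cost_not hN]

theorem price_shift (F : Frame P C) (M : Tm P C) {τ : Ty P} (a : Dom τ) :
    price F.shift M a = price F M a := by
  cases F <;> rfl

theorem price_rel {F : Frame P C} {M N : Tm P C} (h : IsValue M → IsValue N) {τ : Ty P} {s : ℕ}
    {a b : Dom τ} (hab : Dom.Rel τ s a b) : price F N a ≤ price F M b := by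
  by_cases hF : F.IsAppR
  · simp [price, hF]
  · simpa [price, hF] using cost_rel h hab

theorem kRel_price {F : Frame P C} {M N : Tm P C} (h : IsValue M → IsValue N) {τ : Ty P}
    {u : ℕ} {k l : Dom τ → ℕ} (hk : Dom.KRel τ u k l) :
    Dom.KRel τ u (fun a => k a + price F N a) (fun a => l a + price F M a) := by
  intro w a b hab
  have h1 := hk w a b hab
  have h2 := price_rel (F := F) h hab
  simp only
  omega

/-- Evaluation contexts extend continuations. -/
theorem Den.of_plugs {Γ : Cx P} {a : Option (Ty P)} {M : Tm P C} (hM : ¬ IsValue M)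
    {E : List (Frame P C)} (hE : Frame.IsEval E) {τ : Ty P} {f : Env P → (Dom τ → ℕ) → ℕ}
    (h : Den (scons a Γ) (Frame.plugs (E.map Frame.shift) M) τ f) :
    ∃ (σ : Ty P) (g : Env P → (Dom σ → ℕ) → ℕ) (K : Env P → (Dom τ → ℕ) → Dom σ → ℕ),
      Den (scons a Γ) M σ g ∧ (f = fun ρ k => g ρ (K (fun i => ρ (Nat.succ i)) k)) ∧
      (∀ ρ ρ' u k l, ERel Γ ρ ρ' → Dom.KRel τ u k l → Dom.KRel σ u (K ρ k) (K ρ' l)) ∧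
      ∀ N g', ¬ IsValue N → Den Γ N σ g' →
        Den Γ (Frame.plugs E N) τ (fun ρ k => g' ρ (K ρ k)) := by
  induction E generalizing τ f with
  | nil =>
    exact ⟨τ, f, fun _ k => k, h, rfl, fun _ _ _ _ _ _ hk => hk, fun _ _ _ h => h⟩
  | cons F E ih =>
    have hF : F.IsSimple := hE F (by simp)
    obtain ⟨σ, K, g, h1, h2, rfl⟩ := FDen.of_plug ((isSimple_shift F).2 hF) h
    obtain ⟨K, hK, rfl⟩ := h1.of_shift hF
    obtain ⟨σ', g, K', h3, rfl, h4, h5⟩ := ih (fun F' h => hE F' (by simp [h])) h2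
    have hM' := not_isValue_plugs (E.map Frame.shift) hM
    -- All non-values are charged alike in a given frame, so the transformer formed with `M` also
    -- serves every other non-value.
    refine ⟨σ', g, fun ρ k => K' ρ (fun a => K ρ k a + price F M a), h3, ?_, ?_, ?_⟩
    · funext ρ k
      simp only [price_shift]
      congr 2
      funext a
      rw [price_not hM hM']
      rfl
    · intro ρ ρ' u k l hρ hk
      exact h4 _ _ _ _ _ hρ (kRel_price id (hK.self hρ hk))
    · intro N g' hN hg'
      have := hK.plug (h5 N g' hN hg')
      simp only [price_not (not_isValue_plugs E hN) hM] at this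
      exact this

-- Size and weight: the syntactic measure for lift.

mutual
/-- The size of a term. -/
def size : Tm P C → ℕ
  | const _ _ => 1
  | var _ => 1
  | lam _ M => size M + 1
  | app M N => size M + size N + 1
  | box _ Ns M => sizeList Ns + size M + 1
/-- The size of a list of terms. -/
def sizeList : List (Tm P C) → ℕ
  | [] => 0
  | N :: Ns => size N + sizeList Ns
end

open Classical in
mutual
/-- The total size of the contents of the evaluation frames in a term. -/
noncomputable def weight : Tm P C → ℕ
  | const _ _ => 0
  | var _ => 0
  | lam _ M => weight M
  | app M N => weight M + weight N + size N + if IsValue M then 0 else size M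
  | box _ Ns M => weightList Ns + weight M
/-- The total size of the contents of the evaluation frames in a list of box arguments. -/
noncomputable def weightList : List (Tm P C) → ℕ
  | [] => 0
  | N :: Ns => weight N + size N + weightList Ns
end

theorem sizeList_append (Ls Ns : List (Tm P C)) :
    sizeList (Ls ++ Ns) = sizeList Ls + sizeList Ns := by
  induction Ls with
  | nil => simp [sizeList]
  | cons L Ls ih => simp [sizeList, ih, add_assoc]

theorem weightList_append (Ls Ns : List (Tm P C)) :
    weightList (Ls ++ Ns) = weightList Ls + weightList Ns := by
  induction Ls with
  | nil => simp [weightList]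
  | cons L Ls ih => simp [weightList, ih, add_assoc]

mutual
theorem size_rename (r : ℕ → ℕ) : ∀ M : Tm P C, size (rename r M) = size M
  | const c τ => by rw [rename]
  | var i => by rw [rename, size, size]
  | lam σ M => by rw [rename, size, size, size_rename]
  | app M N => by rw [rename, size, size, size_rename, size_rename]
  | box Δ Ns M => by rw [rename, size, size, sizeList_rename]
theorem sizeList_rename (r : ℕ → ℕ) : ∀ Ns : List (Tm P C), sizeList (renameList r Ns) = sizeList Ns
  | [] => by rw [renameList]
  | N :: Ns => by rw [renameList, sizeList, sizeList, size_rename, sizeList_rename]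
end

mutual
theorem weight_rename (r : ℕ → ℕ) : ∀ M : Tm P C, weight (rename r M) = weight M
  | const c τ => by rw [rename]
  | var i => by rw [rename, weight, weight]
  | lam σ M => by rw [rename, weight, weight, weight_rename]
  | app M N => by
      rw [rename, weight, weight, weight_rename, weight_rename, size_rename, size_rename]
      by_cases h : IsValue M
      · rw [if_pos h, if_pos ((isValue_rename r M).2 h)]
      · rw [if_neg h, if_neg (mt (isValue_rename r M).1 h)]
  | box Δ Ns M => by rw [rename, weight, weight, weightList_rename]
theorem weightList_rename (r : ℕ → ℕ) :
    ∀ Ns : List (Tm P C), weightList (renameList r Ns) = weightList Ns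
  | [] => by rw [renameList]
  | N :: Ns => by
      rw [renameList, weightList, weightList, weight_rename, size_rename, weightList_rename]
end

/-- `N` has the size of `M` and a smaller weight. -/
def Lighter (N M : Tm P C) : Prop := size N = size M ∧ weight N < weight M

/-- Before the step the hole of the frame holds the whole redex, afterwards at most the body `M`;
the argument `N` is counted as a content of its own on both sides. Equality of sizes is kept because
the weight of a surrounding frame depends on the size of its content. -/
theorem lighter_lift {F : Frame P C} (hF : F.IsSimple) (σ : Ty P) (M N : Tm P C) :
    Lighter (app (lam σ (F.shift.plug M)) N) (F.plug (app (lam σ M) N)) := by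
  have hl : ∀ M : Tm P C, IsValue (lam σ M) := fun M => .lam σ M
  have ha := not_isValue_app (lam σ M) N
  cases F with
  | appL L =>
    simp only [Frame.shift, Frame.plug, Lighter, size, weight, hl, ha, shift, size_rename,
      weight_rename, if_true, if_false]
    split_ifs <;> constructor <;> omega
  | appR V =>
    have hV : IsValue V := hF
    simp only [Frame.shift, Frame.plug, Lighter, size, weight, hl, hV, shift, size_rename,
      weight_rename, if_true, isValue_rename]
    constructor <;> omega
  | box Δ Ls Ns V =>
    simp only [Frame.shift, Frame.plug, Lighter, size, weight, hl, map_shift, sizeList_append,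
      sizeList, weightList_append, weightList, sizeList_rename, weightList_rename, if_true]
    constructor <;> omega

/-- Needed for the congruence cases: there the charges must not rise, and a box body must remain a
value. -/
theorem Contract.isValue {r : Rule} {Γ : List (Ty P)} {M N : Tm P C} (h : Contract r Γ M N)
    (hM : IsValue M) : IsValue N := by
  cases h with
  | idArr σ M => exact absurd hM (not_isValue_app _ _)
  | betaArrV σ M V hV => exact absurd hM (not_isValue_app _ _)
  | etaArrV σ V hV => exact hV
  | lift F σ M N hF => exact absurd hM (not_isValue_plug F (not_isValue_app _ _))
  | flat F σ y M hF _ _ => exact absurd hM (not_isValue_plug F (not_isValue_app _ _))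
  | betaOmega E σ y M hE => exact absurd hM (not_isValue_app _ _)
  | idBox σ M => exact isValue_box.1 hM _ (by simp)
  | betaBoxV ws ys zs σ Ws Ns Ps V M hl hW hV =>
    rw [isValue_box] at hM ⊢
    have := isValue_box.1 (hM (box ys Ns V) (by simp))
    intro L hL
    simp only [List.mem_append] at hL
    rcases hL with (h | h) | h
    · exact hM L (by simp [h])
    · exact this L h
    · exact hM L (by simp [h])

theorem Step.isValue {X : Set Rule} {Γ : List (Ty P)} {M N : Tm P C} (h : Step X Γ M N)
    (hM : IsValue M) : IsValue N := by
  induction h with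
  | root r _ h => exact h.isValue hM
  | lam _ _ => exact .lam _ _
  | appL _ _ => exact absurd hM (not_isValue_app _ _)
  | appR _ _ => exact absurd hM (not_isValue_app _ _)
  | boxArg _ ih =>
    rw [isValue_box] at hM ⊢
    intro L hL
    simp only [List.mem_append, List.mem_cons] at hL
    rcases hL with h | rfl | h
    · exact hM L (by simp [h])
    · exact ih (hM _ (by simp))
    · exact hM L (by simp [h])
  | boxBody _ _ => rw [isValue_box] at hM ⊢; exact hM

-- Each contraction decreases the denotation or the weight.

/-- The denotation decreases, or it does not increase and the term gets lighter. -/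
def Decreases (Γ : Cx P) (N M : Tm P C) {τ : Ty P} (g f : Env P → (Dom τ → ℕ) → ℕ) : Prop :=
  SRel Γ 1 g f ∨ SRel Γ 0 g f ∧ Lighter N M

theorem kRel_boxD {τ : Ty P} {u : ℕ} {k l : Dom (.box τ) → ℕ}
    {v w : Env P → Dom τ} (hk : Dom.KRel (.box τ) u k l)
    {t : ℕ} {A : (Env P → ℕ) → ℕ} {B : (Env P → ℕ) → ℕ}
    (h : ∀ x κ μ, Dom.KRel τ x κ μ → A (fun e => κ (v e)) + t + x ≤ B (fun e => μ (w e))) :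
    k (boxD v A) + u + t ≤ l (boxD w B) := by
  refine hk t _ _ fun x κ μ hκ => ?_
  have := h x κ μ hκ
  simp only [boxD]
  omega

theorem isValue_single {V : Tm P C} (hV : IsValue V) (i : ℕ) : IsValue (single V i) := by
  cases i with
  | zero => exact hV
  | succ i => exact .var i

theorem isValue_splice (m n : ℕ) {V : Tm P C} (hV : IsValue V) (i : ℕ) :
    IsValue (splice m n V i) := by
  rw [splice]
  split_ifs
  · exact .var _
  · exact (isValue_rename _ _).2 hV
  · exact .var _

/-- The environment that interprets `splice m n V`, where `V` denotes `v`. -/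
noncomputable def spliceEnv (m n : ℕ) {σ : Ty P} (v : Env P → Dom σ) (e : Env P) : Env P :=
  scat m e (scons (Dom.inj (v (fun j => e (m + j)))) (fun j => e (m + n + j)))

theorem den_splice {ws ys zs : List (Ty P)} {σ : Ty P} {V : Tm P C} {v : Env P → Dom σ}
    (hv : Den (cx ys) V σ (fun e k => k (v e))) (i : ℕ) (τ : Ty P)
    (hi : cx (ws ++ σ :: zs) i = some τ) :
    Den (cx (ws ++ (ys ++ zs))) (splice ws.length ys.length V i) τ
      (fun e k => k (spliceEnv ws.length ys.length v e i τ)) := by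
  rcases lt_trichotomy i ws.length with h | rfl | h
  · simp only [splice, spliceEnv, scat, h, if_true]
    refine .var ?_
    simpa [cx, List.getElem?_append, h] using hi
  · obtain rfl : σ = τ := by simpa [cx] using hi
    simp only [splice, spliceEnv, scat, lt_irrefl, if_true, if_false, Nat.sub_self, scons_zero,
      Dom.inj_self]
    refine Den.rename (fun j τ hj => ?_) hv
    have hj' : j < ys.length := (List.getElem?_eq_some_iff.1 hj).1
    simpa [cx, List.getElem?_append, hj'] using hj
  · obtain ⟨j, rfl⟩ : ∃ j, i = ws.length + (j + 1) := ⟨i - ws.length - 1, by omega⟩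
    have h1 : ¬ ws.length + (j + 1) < ws.length := by omega
    have h2 : ¬ ws.length + (j + 1) = ws.length := by omega
    have h3 : ws.length + (j + 1) - 1 + ys.length = ws.length + ys.length + j := by omega
    simp only [splice, spliceEnv, scat, h1, h2, h3, if_false, Nat.add_sub_cancel_left,
      scons_succ]
    refine .var ?_
    have h4 : ws.length + ys.length + j = ws.length + (ys.length + j) := by omega
    rw [h4]
    simpa [cx, List.getElem?_append] using hi

theorem eRel_spliceEnv {ws ys zs : List (Ty P)} {σ : Ty P} {V : Tm P C} {v : Env P → Dom σ}
    (hv : Den (cx ys) V σ (fun e k => k (v e))) {e₁ e₁' e₂ e₂' e₃ e₃' : Env P}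
    (h₁ : ERel (cx ws) e₁ e₁') (h₂ : ERel (cx ys) e₂ e₂') (h₃ : ERel (cx zs) e₃ e₃') :
    ERel (cx (ws ++ σ :: zs))
      (spliceEnv ws.length ys.length v (scat ws.length e₁ (scat ys.length e₂ e₃)))
      (scat ws.length e₁' (scons (Dom.inj (v e₂')) e₃')) := by
  refine ERel.scat ?_ ?_
  · intro i τ hi
    have : i < ws.length := (List.getElem?_eq_some_iff.1 hi).1
    simpa [scat, this] using h₁ i τ hi
  · rw [cx_cons]
    have h4 : (fun j => scat ws.length e₁ (scat ys.length e₂ e₃) (ws.length + ys.length + j))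
        = e₃ := by
      funext j
      have : ¬ ws.length + ys.length + j < ws.length := by omega
      have h' : ws.length + ys.length + j - ws.length = ys.length + j := by omega
      simp [scat, this, h']
    rw [h4]
    refine h₃.scons (hv.self_value ?_)
    intro i τ hi
    have : i < ys.length := (List.getElem?_eq_some_iff.1 hi).1
    simpa [scat, this] using h₂ i τ hi

/-- Merging the inner box keeps the order in which arguments are run, so the two sides can be
compared block by block: first `Ws`, then `Ns`, then `Ps`. What is saved is the 1 of the inner
`boxD`; dropping its `cost` and the measure of its content only helps. -/
theorem Contract.den_betaBoxV {Γ : Cx P} {ws ys zs : List (Ty P)} {σ τ : Ty P}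
    {Ws Ns Ps : List (Tm P C)} {V M : Tm P C} (hl : ws.length = Ws.length) (hV : IsValue V)
    {f : Env P → (Dom τ → ℕ) → ℕ}
    (h : Den Γ (box (ws ++ σ :: zs) (Ws ++ box ys Ns V :: Ps) M) τ f) :
    ∃ g, Den Γ (box (ws ++ ys ++ zs) (Ws ++ Ns ++ Ps)
      (subst (splice ws.length ys.length V) M)) τ g ∧ SRel Γ 1 g f := by
  cases h with
  | box hA hM hm =>
    rename_i τ H m
    obtain ⟨Δ, Θ, F, G, e, hF, hG, rfl⟩ := hA.of_append
    obtain ⟨rfl, rfl⟩ := List.append_inj e (hl.trans hF.length_eq)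
    cases hG with
    | cons hb hP =>
      cases hb with
      | box hN _ hv =>
        rename_i G N _ v
        rw [List.append_assoc, List.append_assoc]
        refine ⟨_, .box (hF.append (hN.append hP)) ((isValue_subst (isValue_splice _ _ hV) M).2 hM)
          (hm.subst (isValue_splice _ _ hV)
            (w := spliceEnv ws.length ys.length v) (den_splice hv)), ?_⟩
        intro ρ ρ' u k l hρ hk
        refine le_of_eq_of_le ?_ (hF.self ρ ρ' (u + 1)
          (fun A => N ρ fun B => G ρ fun D => k (boxD
            (fun e => m (spliceEnv ws.length ys.length v e))
            (catB ws.length A (catB ys.length B D))))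
          _ hρ ?_)
        · simp only; omega
        intro t₁ A A' hA
        refine le_of_eq_of_le ?_ (hN.self ρ ρ' (u + 1 + t₁)
          (fun B => G ρ fun D => k (boxD
            (fun e => m (spliceEnv ws.length ys.length v e))
            (catB ws.length A (catB ys.length B D))))
          _ hρ ?_)
        · simp only; omega
        intro t₂ B B' hB
        have := hP.self ρ ρ' (u + t₁ + t₂ + 1)
          (fun D => k (boxD
            (fun e => m (spliceEnv ws.length ys.length v e))
            (catB ws.length A (catB ys.length B D))))
          (fun D => l (boxD m (catB ws.length A' (consB (boxD v B') D)))) hρ (by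
          intro t₃ D D' hD
          have := kRel_boxD (t := t₁ + t₂ + t₃ + 1)
            (v := fun e => m (spliceEnv ws.length ys.length v e))
            (A := catB ws.length A (catB ys.length B D)) (w := m)
            (B := catB ws.length A' (consB (boxD v B') D')) hk (by
            intro x κ μ hκ
            have := hA (t₂ + t₃ + 1 + x) (fun e₁ => B fun e₂ => D fun e₃ =>
                κ (m (spliceEnv ws.length ys.length v
                  (scat ws.length e₁ (scat ys.length e₂ e₃))))) (fun e => consB (boxD v B') D'
                (fun e' => μ (m (scat ws.length e e'))))
              (fun e₁ e₁' h₁ => by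
              have := hB (t₃ + x) (fun e₂ => D fun e₃ => κ (m (spliceEnv ws.length ys.length v
                  (scat ws.length e₁ (scat ys.length e₂ e₃))))) (fun e₂ => D' (fun e => μ (m (scat ws.length e₁'
                  (scons (Dom.inj (v e₂)) e)))) + Dom.meas σ (v e₂))
                (fun e₂ e₂' h₂ => by
                have := hD x _ _ (fun e₃ e₃' h₃ => by
                  have := hκ 0 _ _ (hm.self_value (eRel_spliceEnv hv h₁ h₂ h₃))
                  exact this)
                refine le_trans (le_of_eq ?_) (this.trans (Nat.le_add_right _ _))
                omega)
              -- Here the 1 charged by the inner box becomes the required gap.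
              simp only [consB, boxD]
              refine le_trans (le_of_eq ?_) (Nat.add_le_add_right this 1)
              omega)
            refine le_trans (le_of_eq ?_) this
            simp only [catB]
            omega)
          simp only
          omega)
        simp only at this ⊢
        omega

theorem Den.bound {Γ : Cx P} {M : Tm P C} {τ : Ty P} {f : Env P → (Dom τ → ℕ) → ℕ}
    (h : Den Γ M τ f) {ρ ρ' : Env P} (hρ : ERel Γ ρ ρ') {u : ℕ} {k l : Dom τ → ℕ}
    (hk : Dom.KRel τ u k l) : f ρ k + u ≤ f ρ' l :=
  h.self ρ ρ' u k l hρ hk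

theorem Den.of_var {Γ : Cx P} {i : ℕ} {τ : Ty P} {f : Env P → (Dom τ → ℕ) → ℕ}
    (h : Den Γ (Tm.var i : Tm P C) τ f) : Γ i = some τ ∧ f = fun ρ k => k (ρ i τ) := by
  cases h with
  | var h => exact ⟨h, rfl⟩

theorem Contract.den {r : Rule} {Γ : List (Ty P)} {M N : Tm P C} (h : Contract r Γ M N) {τ : Ty P}
    {f : Env P → (Dom τ → ℕ) → ℕ} (hf : Den (cx Γ) M τ f) :
    ∃ g, Den (cx Γ) N τ g ∧ Decreases (cx Γ) N M g f := by
  cases h with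
  | idArr σ M =>
    cases hf with
    | app h1 h2 =>
      cases h1 with
      | lam h1 =>
        cases h1 with
        | var h =>
          obtain rfl : σ = τ := by simpa using h
          refine ⟨_, h2, .inl fun ρ ρ' u k l hρ hk => ?_⟩
          -- The continuation built by `absD` exceeds `k` by at least 1, so the gap is asked for at
          -- `u + 1`.
          refine le_trans (by omega) ((h2.bound (u := u + 1) (k := k) hρ ?_).trans
            (Nat.le_add_right _ _))
          intro v a b hab
          have := hk v a b hab
          simp only [absD, scons_zero, Dom.inj_self]
          omega
  | betaArrV σ M V hV =>
    cases hf with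
    | app h1 h2 =>
      cases h1 with
      | lam h1 =>
        obtain ⟨v, rfl⟩ := h2.exists_value hV
        refine ⟨_, h1.subst (isValue_single hV) (w := fun ρ => scons (Dom.inj (v ρ)) ρ) ?_,
          .inl fun ρ ρ' u k l hρ hk => ?_⟩
        · intro i τ hi
          cases i with
          | zero =>
            obtain rfl : σ = τ := by simpa using hi
            simpa [single] using h2
          | succ i => exact .var hi
        · have := h1.bound (hρ.scons (h2.self_value hρ)) hk
          simp only [absD]
          omega
  | etaArrV σ V hV =>
    cases hf with
    | lam h =>
      cases h with
      | app h1 h2 =>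
        cases h2 with
        | var h =>
          obtain rfl := Option.some.inj h
          obtain ⟨g, hg, rfl⟩ := h1.of_shift
          obtain ⟨v, rfl⟩ := hg.exists_value hV
          refine ⟨_, hg, .inl fun ρ ρ' u k l hρ hk => ?_⟩
          -- The gap 1 between `V` and its expansion is the 1 in `absD`.
          refine le_trans (by simp only; omega) (hk 1 (v ρ) _ ?_)
          intro t w a b κ μ hab hκ
          have := (hg.self_value hρ).arr hab hκ
          simp only [absD, scons_zero, Dom.inj_self, scons_comp_succ]
          omega
  | lift F σ M N hF =>
    obtain ⟨σ', K, g, hK, h, rfl⟩ := FDen.of_plug hF hf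
    cases h with
    | app h1 h2 =>
      cases h1 with
      | lam h1 =>
        refine ⟨_, (hK.shift.plug h1).lam.app h2, .inr ⟨?_, lighter_lift hF σ M N⟩⟩
        intro ρ ρ' u k l hρ hk
        simp only [cost_value (IsValue.lam _ _), Nat.add_zero, absD, scons_comp_succ, price_shift]
        refine h2.bound hρ fun t a b hab => ?_
        -- Both sides run `N` and then `M`; only the price in the frame may differ, and it is
        -- largest for the redex, which is not a value.
        have h3 := h1.bound (hρ.scons hab)
          (kRel_price (F := F) (M := app (lam σ M) N) (N := M) (fun h => by cases h)
            (hK.self hρ hk))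
        have h4 := Dom.meas_rel hab
        omega
  | flat F σ y M hF hF' hy =>
    obtain ⟨σ', K, g, hK, h, rfl⟩ := FDen.of_plug hF hf
    -- The annotation of the new binder agrees with the type in the denotation, because the context
    -- fixes the type of `y`.
    obtain rfl : σ' = σ := by
      cases hy with
      | app h1 _ =>
        cases h1 with
        | var h1 =>
          cases h with
          | app h2 _ =>
            cases h2 with
            | var h2 =>
              have := h2.symm.trans h1
              simp only [Option.some.injEq, Ty.arr.injEq] at this
              exact this.2
    refine ⟨_, ((hK.shift (a := some σ')).plug (M := var 0) (.var rfl)).lam.app h, .inl ?_⟩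
    intro ρ ρ' u k l hρ hk
    simp only [cost_value (IsValue.lam _ _), Nat.add_zero, absD, scons_comp_succ, price_shift,
      scons_zero, Dom.inj_self]
    rw [add_assoc]
    refine h.bound hρ fun t a b hab => ?_
    have h3 := hK.self hρ hk t a b hab
    have h4 := Dom.meas_rel hab
    -- The variable is free where the application paid its measure plus 2; the new abstraction takes
    -- back its measure plus 1, leaving a gap of 1.
    have h5 : price F (var 0 : Tm P C) a = 0 := by
      rw [price, if_neg hF', cost_value (.var 0)]
    have h6 : price F (app (var y) M) b = Dom.meas σ' b + 2 := by
      rw [price, if_neg hF', cost_not (not_isValue_app _ _)]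
    omega
  | betaOmega E σ y M hE =>
    cases hf with
    | app h1 h2 =>
      cases h1 with
      | lam h1 =>
        obtain ⟨τ', g, K, h3, rfl, hK, h4⟩ := h1.of_plugs (not_isValue_app _ _) hE
        cases h3 with
        | app h5 h6 =>
          cases h5 with
          | var h5 =>
            cases h6 with
            | var h6 =>
              obtain rfl := Option.some.inj h6
              refine ⟨_, h4 _ _ (not_isValue_app _ _) (Den.app (.var h5) h2), .inl ?_⟩
              intro ρ ρ' u k l hρ hk
              simp only [cost_value (IsValue.lam _ _), cost_value (IsValue.var _), Nat.add_zero,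
                absD, scons_comp_succ, scons_zero, Dom.inj_self]
              simp only [scons_succ]
              rw [add_assoc]
              refine h2.bound hρ fun t a b hab => ?_
              -- After `M` has run, both sides apply `y` to its value with the same context as
              -- continuation; the charge of the abstraction is what disappears.
              have := (hρ y _ h5).arr hab (hK ρ ρ' u k l hρ hk)
              omega
  | idBox σ M =>
    cases hf with
    | box h1 _ h2 =>
      cases h1 with
      | cons h1 h3 =>
        cases h3
        rename_i τ v _ f
        obtain ⟨h4, h5⟩ := h2.of_var
        obtain rfl : σ = τ := by simpa [cx] using h4
        refine ⟨_, h1, .inl fun ρ ρ' u k l hρ hk => ?_⟩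
        rw [add_assoc]
        refine h1.bound hρ fun t b b' hb => ?_
        -- The extra 1 is the charge of `boxD`; the measure added by `consB` is given away.
        have := hk (t + 1) b (boxD v (consB b' fun κ => κ dEnv)) (by
          intro x κ μ hκ
          have hv : ∀ e, μ (v e) = μ (e 0 σ) := fun e => congrFun (congrFun h5 e) μ
          have := hb.box (u := x) (k := κ) (l := fun a => μ a + Dom.meas σ a) (by
            intro w c d hcd
            have := hκ w c d hcd
            simp only
            omega)
          simp only [boxD, consB, hv, scons_zero, Dom.inj_self]
          omega)
        simp only
        omega
  | betaBoxV ws ys zs σ Ws Ns Ps V M hl hW hV =>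
    obtain ⟨g, hg, h⟩ := Contract.den_betaBoxV hl hV hf
    exact ⟨g, hg, .inl h⟩

-- From contractions to reduction steps and termination.

/-- Reduction decreases denotations. -/
theorem Step.den {Γ : List (Ty P)} {M N : Tm P C} (h : Step rulesV Γ M N) {τ : Ty P}
    {f : Env P → (Dom τ → ℕ) → ℕ} (hf : Den (cx Γ) M τ f) :
    ∃ g, Den (cx Γ) N τ g ∧ Decreases (cx Γ) N M g f := by
  induction h generalizing τ with
  | root r _ h => exact h.den hf
  | lam h ih =>
    cases hf with
    | lam hf =>
      rw [← cx_cons] at hf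
      obtain ⟨g, hg, hd⟩ := ih hf
      rw [cx_cons] at hg hd
      refine ⟨_, .lam hg, hd.imp SRel.lam fun ⟨h1, h2, h3⟩ => ⟨h1.lam, ?_, ?_⟩⟩
      · simp only [size, h2]
      · simpa only [weight] using h3
  | appL h ih =>
    cases hf with
    | app h1 h2 =>
      obtain ⟨g, hg, hd⟩ := ih h1
      refine ⟨_, hg.app h2, hd.imp (fun hd => SRel.app hd h2.self h.isValue)
        fun ⟨hd, h3, h4⟩ => ⟨SRel.app hd h2.self h.isValue, ?_, ?_⟩⟩
      · simp only [size, h3]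
      · have := h.isValue
        simp only [weight]
        split_ifs <;> first | omega | (exfalso; tauto)
  | appR h ih =>
    cases hf with
    | app h1 h2 =>
      obtain ⟨g, hg, hd⟩ := ih h2
      refine ⟨_, h1.app hg, hd.imp (fun hd => ?_) fun ⟨hd, h3, h4⟩ => ⟨h1.self.app hd id, ?_, ?_⟩⟩
      · simpa using h1.self.app hd id
      · simp only [size, h3]
      · simp only [weight, h3]
        omega
  | boxArg h ih =>
    cases hf with
    | box h1 hV h2 =>
      obtain ⟨Δ, Θ, F, G, rfl, hF, hG, rfl⟩ := h1.of_append
      cases hG with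
      | cons h3 h4 =>
        obtain ⟨g, hg, hd⟩ := ih h3
        refine ⟨_, .box (hF.append (.cons hg h4)) hV h2, hd.imp (fun hd => ?_)
          fun ⟨hd, h5, h6⟩ => ⟨?_, ?_, ?_⟩⟩
        · exact SRel.box (hF.self.append (LRel.cons hd h4.self h.isValue)) h2.self
        · exact SRel.box (hF.self.append (LRel.cons hd h4.self h.isValue)) h2.self
        · simp only [size, sizeList_append, sizeList, h5]
        · simp only [weight, weightList_append, weightList, h5]
          omega
  | boxBody h ih =>
    cases hf with
    | box h1 hV h2 =>
      obtain ⟨g, hg, hd⟩ := ih h2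
      have hV' := h.isValue hV
      -- The reduced body is again a value, so it denotes an element, as the box clause of `Den`
      -- demands.
      obtain ⟨v, rfl⟩ := hg.exists_value hV'
      refine ⟨_, .box h1 hV' hg, hd.imp (fun hd => ?_)
        fun ⟨hd, h5, h6⟩ => ⟨SRel.box h1.self hd, ?_, ?_⟩⟩
      · simpa using SRel.box h1.self hd
      · simp only [size, h5]
      · simp only [weight]
        omega

/-- Typed terms of the call-by-value calculus have denotations. -/
theorem HasType.exists_den {Γ : List (Ty P)} {M : Tm P C} {τ : Ty P} (h : HasType Γ M τ)
    (hM : IsCbv M) : ∃ f, Den (cx Γ) M τ f := by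
  induction h with
  | const c τ => exact ⟨_, .const c τ⟩
  | var h => exact ⟨_, .var h⟩
  | lam _ ih =>
    cases hM with
    | lam _ hM =>
      obtain ⟨f, hf⟩ := ih hM
      rw [cx_cons] at hf
      exact ⟨_, .lam hf⟩
  | app _ _ ih1 ih2 =>
    cases hM with
    | app h1 h2 =>
      obtain ⟨f, hf⟩ := ih1 h1
      obtain ⟨g, hg⟩ := ih2 h2
      exact ⟨_, hf.app hg⟩
  | box hl h3 h4 ih1 ih2 =>
    cases hM with
    | box _ h1 hV h2 =>
      rename_i Γ Δ τ Ns M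
      obtain ⟨g, hg⟩ := ih2 h2
      obtain ⟨v, rfl⟩ := hg.exists_value hV
      suffices H : ∃ F, DenL (cx Γ) Ns Δ F by
        obtain ⟨F, hF⟩ := H
        exact ⟨_, .box hF hV hg⟩
      clear ih2 hg hV h2 v h3 h4
      induction Ns generalizing Δ with
      | nil =>
        obtain rfl : Δ = [] := by simpa using hl.symm
        exact ⟨_, .nil⟩
      | cons N Ns ih =>
        cases Δ with
        | nil => simp at hl
        | cons σ Δ =>
          obtain ⟨f, hf⟩ := ih1 0 N σ rfl rfl (h1 N (by simp))
          obtain ⟨F, hF⟩ := ih (by simpa using hl) (fun i N σ h h' => ih1 (i + 1) N σ h h')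
            (fun N h => h1 N (by simp [h]))
          exact ⟨_, .cons hf hF⟩

theorem eRel_dEnv (Γ : Cx P) : ERel Γ dEnv dEnv := fun _ τ _ => (Dom.base_rel τ).1

theorem Den.stronglyNormalizing {Γ : List (Ty P)} {M : Tm P C} {τ : Ty P}
    {f : Env P → (Dom τ → ℕ) → ℕ} (h : Den (cx Γ) M τ f) : StronglyNormalizing rulesV Γ M := by
  -- Lexicographic induction, the answer first and the weight second: the weight may grow whenever
  -- the answer drops.
  induction hn : f dEnv (Dom.meas τ) using Nat.strong_induction_on generalizing M f with
  | _ n ihn =>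
    induction hw : weight M using Nat.strong_induction_on generalizing M f with
    | _ w ihw =>
      refine Acc.intro _ fun N hN => ?_
      obtain ⟨g, hg, hd | ⟨hd, -, hwt⟩⟩ := Step.den hN h
      · have := hd _ _ 0 _ _ (eRel_dEnv _) (Dom.base_rel τ).2
        exact ihn _ (by simp only [Dom.meas] at *; omega) hg rfl
      · have := hd _ _ 0 _ _ (eRel_dEnv _) (Dom.base_rel τ).2
        have hle : g dEnv (Dom.meas τ) ≤ n := by simp only [Dom.meas] at *; omega
        rcases hle.lt_or_eq with hlt | heq
        · exact ihn _ hlt hg rfl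
        · exact ihw _ (hw ▸ hwt) hg heq rfl

end Tm

theorem proposition7 {P C : Type*} (Γ : List (Ty P)) (M : Tm P C) (τ : Ty P)
    (hM : Tm.IsCbv M) (hτ : Tm.HasType Γ M τ) :
    Tm.StronglyNormalizing rulesV Γ M := by
  obtain ⟨f, hf⟩ := hτ.exists_den hM
  exact hf.stronglyNormalizing
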